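/- On $L^2((0,1),\mathbb C)$ with $\langle f,g\rangle=\int_0^1 f\overline g\,dx$, let $A=-\partial_{xx}^2$ with domain $H^2\cap H^1_0((0,1),\mathbb C)$, and for $k\ge 1$ put $\lambda_k=(k\pi)^2$, $\varphi_k(x)=\sqrt2\sin(k\pi x)$ and $\Phi_k(t)=e^{-i\lambda_k t}\varphi_k$. Let $H^3_{(0)}=\mathcal D(A^{3/2})$ with norm $\big(\sum_{k\ge1}|k^3\langle f,\varphi_k\rangle|^2\big)^{1/2}$. For $T>0$, $u\in L^2((0,T),\mathbb R)$ and $j\in\{1,2\}$, let $\psi^j\in C^0([0,T],H^3_{(0)})$ be the weak solution of $$i\partial_t\psi^j=-\partial^2_{xx}\psi^j-u(t)\mu(x)\psi^j,\qquad \psi^j(t,0)=\psi^j(t,1)=0,\qquad \psi^j(0,\cdot)=\varphi_j,$$ that is, $\psi^j(t)=e^{-iAt}\varphi_j+i\int_0^t e^{-iA(t-\tau)}[u(\tau)\mu\psi^j(\tau)]\,d\tau$ for every $t\in[0,T]$. **Theorem.** Let $\mu\in H^3((0,1),\mathbb R)$ be such that $$\mathcal A:=\langle\mu\varphi_1,\varphi_1\rangle\langle(\mu')^2\varphi_2,\varphi_2\rangle-\langle\mu\varphi_2,\varphi_2\rangle\langle(\mu')^2\varphi_1,\varphi_1\rangle\neq0,$$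 and let $\alpha:=\operatorname{sign}(\mathcal A\langle\mu\varphi_1,\varphi_1\rangle)$, with $\operatorname{sign}(0)=0$ (so $\alpha\in\{-1,1\}$ as soon as $\langle\mu\varphi_1,\varphi_1\rangle\ne0$). There exist $T_*>0$ and $\varepsilon>0$ such that for every $T\in(0,T_*)$, every $u\in L^2((0,T),\mathbb R)$ with $\|u\|_{L^2(0,T)}<\varepsilon$ and every $\delta>0$, $$\big(\psi^1(T),\psi^2(T)\big)\neq\Big(\Phi_1(T),\big(\sqrt{1-\delta^2}+i\alpha\delta\big)\Phi_2(T)\Big),$$ where $\sqrt{1-\delta^2}$ is read as $0$ when $\delta>1$. -/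

import Mathlib

open Set Filter Topology MeasureTheory
open scoped ENNReal ContDiff InnerProductSpace

noncomputable section

namespace SchrodingerControl

/-- Lebesgue measure on the interval `(0,1)`. -/
def unitMeasure : Measure ℝ := (volume : Measure ℝ).restrict (Ioo (0 : ℝ) 1)

/-- The complex Hilbert space `L²((0,1), ℂ)`. -/
abbrev L2 : Type := Lp ℂ 2 unitMeasure

/-! ### The Sobolev spaces `H^m((0,1), ℝ)` -/

/-- `g` is the weak derivative of `f` on `(0,1)`. -/
def IsWeakDeriv (f g : ℝ → ℝ) : Prop :=
  LocallyIntegrableOn f (Ioo (0 : ℝ) 1) volume ∧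
  LocallyIntegrableOn g (Ioo (0 : ℝ) 1) volume ∧
  ∀ χ : ℝ → ℝ, ContDiff ℝ ∞ χ → HasCompactSupport χ → tsupport χ ⊆ Ioo (0 : ℝ) 1 →
    ∫ x in Ioo (0 : ℝ) 1, f x * deriv χ x = -∫ x in Ioo (0 : ℝ) 1, g x * χ x

/-- `f ∈ H^m((0,1), ℝ)`: `f` and its weak derivatives up to order `m` are in `L²(0,1)`. -/
def MemSobolev : ℕ → (ℝ → ℝ) → Prop
  | 0, f => MemLp f 2 unitMeasure
  | m + 1, f => MemLp f 2 unitMeasure ∧ ∃ g : ℝ → ℝ, IsWeakDeriv f g ∧ MemSobolev m g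

/-! ### Spectral data of the Dirichlet Laplacian `A = -∂²ₓₓ` on `(0,1)` -/

/-- The eigenvalue `λ_k = (k π)²`. -/
def eigenvalue (k : ℕ+) : ℝ := ((k : ℝ) * Real.pi) ^ 2

/-- The eigenfunction `φ_k(x) = √2 sin(k π x)`. -/
def eigenfun (k : ℕ+) (x : ℝ) : ℝ := Real.sqrt 2 * Real.sin ((k : ℝ) * Real.pi * x)

theorem memLp_eigenfun (k : ℕ+) :
    MemLp (fun x : ℝ => (eigenfun k x : ℂ)) 2 unitMeasure := by
  have : IsFiniteMeasure unitMeasure := by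
    unfold unitMeasure
    exact ⟨by simp⟩
  refine MemLp.of_bound (C := Real.sqrt 2) ?_ ?_
  · refine Continuous.aestronglyMeasurable ?_
    unfold eigenfun
    fun_prop
  · refine Eventually.of_forall fun x => ?_
    rw [Complex.norm_real, eigenfun, norm_mul, Real.norm_of_nonneg (Real.sqrt_nonneg 2)]
    exact mul_le_of_le_one_right (Real.sqrt_nonneg 2) (Real.abs_sin_le_one _)

/-- `φ_k` as an element of `L²((0,1), ℂ)`. -/
def eigenvec (k : ℕ+) : L2 := (memLp_eigenfun k).toLp _

/-- The coefficient `⟨f, φ_k⟩ = ∫₀¹ f(x) conj(φ_k(x)) dx`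
(the inner product of Mathlib is conjugate-linear in its first argument). -/
def coeff (f : L2) (k : ℕ+) : ℂ := ⟪eigenvec k, f⟫_ℂ

/-- The eigenstate `Φ_k(t) = e^{-i λ_k t} φ_k`. -/
def eigenstate (k : ℕ+) (t : ℝ) : L2 :=
  Complex.exp (-Complex.I * (eigenvalue k : ℂ) * (t : ℂ)) • eigenvec k

/-- The unitary group `e^{-iAt}` on `L²((0,1), ℂ)`, given by
`e^{-iAt} f = ∑_k e^{-i λ_k t} ⟨f, φ_k⟩ φ_k`. The series converges in `L²` for every `f`
because `(φ_k)` is orthonormal. -/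
def freeGroup (t : ℝ) (f : L2) : L2 :=
  ∑' k : ℕ+, (Complex.exp (-Complex.I * (eigenvalue k : ℂ) * (t : ℂ)) * coeff f k) • eigenvec k

/-- `f ∈ H^s_{(0)} = D(A^{s/2})`, i.e. `∑_k |k^s ⟨f, φ_k⟩|² < ∞`. -/
def MemHzero (s : ℕ) (f : L2) : Prop :=
  Summable fun k : ℕ+ => ‖((k : ℂ) ^ s) * coeff f k‖ ^ 2

/-- The norm of `H^s_{(0)}`. -/
def normHzero (s : ℕ) (f : L2) : ℝ :=
  Real.sqrt (∑' k : ℕ+, ‖((k : ℂ) ^ s) * coeff f k‖ ^ 2)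

/-- `ψ ∈ C⁰([0,T], H^s_{(0)})`. -/
def ContHzero (s : ℕ) (T : ℝ) (ψ : ℝ → L2) : Prop :=
  (∀ t ∈ Icc (0 : ℝ) T, MemHzero s (ψ t)) ∧
  ∀ t₀ ∈ Icc (0 : ℝ) T,
    Tendsto (fun t => normHzero s (ψ t - ψ t₀)) (𝓝[Icc (0 : ℝ) T] t₀) (𝓝 0)

/-! ### The bilinear Schrödinger equation -/

open Classical in
/-- The product `μ f` as an element of `L²((0,1), ℂ)`. For `μ ∈ H¹(0,1)`, hence essentially
bounded on `(0,1)`, the first branch applies to every `f`. -/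
def mulPot (μ : ℝ → ℝ) (f : L2) : L2 :=
  if h : MemLp (fun x : ℝ => (μ x : ℂ) * f x) 2 unitMeasure then h.toLp _ else 0

/-- `ψ` is the weak solution on `[0,T]` of
`i ∂_t ψ = -∂²ₓₓ ψ - u(t) μ(x) ψ`, `ψ(t,0) = ψ(t,1) = 0`, `ψ(0) = ψ₀`: that is,
`ψ ∈ C⁰([0,T], H³_{(0)})` and, for every `t ∈ [0,T]`,
`ψ(t) = e^{-iAt} ψ₀ + i ∫₀ᵗ e^{-iA(t-τ)} [u(τ) μ ψ(τ)] dτ`. -/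
def IsWeakSolution (μ u : ℝ → ℝ) (T : ℝ) (ψ₀ : L2) (ψ : ℝ → L2) : Prop :=
  ContHzero 3 T ψ ∧
  ∀ t ∈ Icc (0 : ℝ) T,
    ψ t = freeGroup t ψ₀ +
      Complex.I • ∫ τ in (0 : ℝ)..t, freeGroup (t - τ) ((u τ : ℂ) • mulPot μ (ψ τ))

/-- `⟨m φ_k, φ_k⟩` for a real function `m` on `(0,1)`. -/
def diagCoeff (m : ℝ → ℝ) (k : ℕ+) : ℝ :=
  ∫ x in Ioo (0 : ℝ) 1, m x * eigenfun k x * eigenfun k x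

/-- The number
`𝒜 = ⟨μ φ₁, φ₁⟩ ⟨(μ')² φ₂, φ₂⟩ - ⟨μ φ₂, φ₂⟩ ⟨(μ')² φ₁, φ₁⟩`, where `μ'` is `dμ`. -/
def quantityA (μ dμ : ℝ → ℝ) : ℝ :=
  diagCoeff μ 1 * diagCoeff (fun x => dμ x ^ 2) 2 -
    diagCoeff μ 2 * diagCoeff (fun x => dμ x ^ 2) 1

end SchrodingerControl

end

/-! In the interaction picture `y_j(t) = e^{iλ_j t} ψ^j(t)`, compare `y_j` with the gauged state
`g_j(σ) = e^{iσμ} φ_j` taken at `σ = s(t) = ∫₀ᵗ u`. This state already carries the control term, so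
in the pairing `⟪g_j(s), y_j⟫` (conjugate-linear on the left) the control cancels by symmetry of
multiplication by `μ`, and `SolvesModes.inner_eq` gives a derivative `i ⟪F_j(s), y_j⟫`, where
`F_j(σ) = (∂²ₓₓ + λ_j) g_j(σ) = O(|σ|)` for bounded `σ`.

Write `a_j = ⟨μφ_j, φ_j⟩`, `m_j = ⟨(μ')²φ_j, φ_j⟩`, `S = ∫₀ᵀ s²`. By `inner_gaugeSource_gauge`,
`⟪F_j(σ), g_j(σ)⟫ = -σ² m_j` exactly. Conservation of the norm bounds `y_j - g_j` by a multiple of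
`∫|s|`, so `⟪g_j(s(T)), y_j(T)⟫ = 1 - i m_j S + O(T S)` (`exists_quadratic_expansion`).

If the targets are reached, the same pairings are multiples of `⟪g_j(σ), φ_j⟫ = 1 - iσ a_j + O(σ²)`,
`σ = s(T)` (`exists_norm_inner_gauge_sub_le`). Imaginary parts for `j = 1` give `σ a₁ ≈ m₁ S`.
Inserted into the relation for `j = 2` times `a₁`, this leaves `a₁ α δ + 𝒜 S ≈ 0`. The choice of `α`
gives both terms the same sign, and all errors are absorbed when `T` and `u` are small
(`exists_sign_obstruction`). If `a₁ = 0`, then `α = 0` and the second target has norm below one,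
which contradicts conservation of the norm. -/

noncomputable section

namespace SchrodingerControl

/-! ### Primitives of integrable functions -/

/-- On `[0,T]`, `f` is a primitive of the integrable function `f'`. -/
def IsPrimitive (T : ℝ) (f f' : ℝ → ℂ) : Prop :=
  IntervalIntegrable f' volume 0 T ∧ ∀ t ∈ Icc (0 : ℝ) T, f t = f 0 + ∫ τ in (0 : ℝ)..t, f' τ

theorem _root_.LipschitzWith.comp_absolutelyContinuousOnInterval {X Y : Type*}
    [PseudoMetricSpace X] [PseudoMetricSpace Y] {K : NNReal} {D : X → Y} {f : ℝ → X} {a b : ℝ}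
    (hD : LipschitzWith K D) (hf : AbsolutelyContinuousOnInterval f a b) :
    AbsolutelyContinuousOnInterval (fun x => D (f x)) a b := by
  unfold AbsolutelyContinuousOnInterval at hf ⊢
  refine squeeze_zero (fun _ => Finset.sum_nonneg fun _ _ => dist_nonneg) (fun E => ?_)
    (by simpa using hf.const_mul (K : ℝ))
  rw [Finset.mul_sum]
  exact Finset.sum_le_sum fun i _ => hD.dist_le_mul _ _

theorem absolutelyContinuousOnInterval_const {X : Type*} [PseudoMetricSpace X] (c : X) (a b : ℝ) :
    AbsolutelyContinuousOnInterval (fun _ => c) a b :=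
  (LipschitzWith.const c).lipschitzOnWith.absolutelyContinuousOnInterval

theorem _root_.AbsolutelyContinuousOnInterval.congr {X : Type*} [PseudoMetricSpace X]
    {f g : ℝ → X} {a b : ℝ} (hf : AbsolutelyContinuousOnInterval f a b)
    (h : EqOn f g (uIcc a b)) : AbsolutelyContinuousOnInterval g a b := by
  rw [absolutelyContinuousOnInterval_iff] at hf ⊢
  intro ε hε
  obtain ⟨δ, hδ, H⟩ := hf ε hε
  refine ⟨δ, hδ, fun E hE hE' => ?_⟩
  refine lt_of_le_of_lt (le_of_eq ?_) (H E hE hE')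
  refine Finset.sum_congr rfl fun i hi => ?_
  rw [h (hE.1 i hi).1, h (hE.1 i hi).2]

theorem lipschitzWith_re : LipschitzWith 1 Complex.re :=
  LipschitzWith.of_dist_le_mul fun x y => by
    simpa [dist_eq_norm, Real.norm_eq_abs] using Complex.abs_re_le_norm (x - y)

theorem lipschitzWith_im : LipschitzWith 1 Complex.im :=
  LipschitzWith.of_dist_le_mul fun x y => by
    simpa [dist_eq_norm, Real.norm_eq_abs] using Complex.abs_im_le_norm (x - y)

theorem lipschitzWith_ofReal : LipschitzWith 1 Complex.ofReal :=
  Complex.isometry_ofReal.lipschitz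

theorem re_intervalIntegral {f : ℝ → ℂ} {a b : ℝ} (hf : IntervalIntegrable f volume a b) :
    (∫ x in a..b, f x).re = ∫ x in a..b, (f x).re :=
  (Complex.reCLM.intervalIntegral_comp_comm hf).symm

theorem im_intervalIntegral {f : ℝ → ℂ} {a b : ℝ} (hf : IntervalIntegrable f volume a b) :
    (∫ x in a..b, f x).im = ∫ x in a..b, (f x).im :=
  (Complex.imCLM.intervalIntegral_comp_comm hf).symm

theorem intervalIntegrable_re {f : ℝ → ℂ} {a b : ℝ} (hf : IntervalIntegrable f volume a b) :
    IntervalIntegrable (fun x => (f x).re) volume a b :=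
  ⟨hf.1.re, hf.2.re⟩

theorem intervalIntegrable_im {f : ℝ → ℂ} {a b : ℝ} (hf : IntervalIntegrable f volume a b) :
    IntervalIntegrable (fun x => (f x).im) volume a b :=
  ⟨hf.1.im, hf.2.im⟩

theorem intervalIntegrable_mono_right {E : Type*} [NormedAddCommGroup E] {f : ℝ → E} {T t : ℝ}
    (hf : IntervalIntegrable f volume 0 T) (ht : t ∈ Icc (0 : ℝ) T) :
    IntervalIntegrable f volume 0 t :=
  hf.mono_set (by rw [uIcc_of_le ht.1, uIcc_of_le (ht.1.trans ht.2)]; exact Icc_subset_Icc_right ht.2)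

theorem absolutelyContinuousOnInterval_intervalIntegral_complex {f : ℝ → ℂ} {T : ℝ}
    (hf : IntervalIntegrable f volume 0 T) (hT : 0 ≤ T) :
    AbsolutelyContinuousOnInterval (fun x => ∫ v in (0 : ℝ)..x, f v) 0 T := by
  have h0 : (0 : ℝ) ∈ uIcc 0 T := left_mem_uIcc
  have h1 := lipschitzWith_ofReal.comp_absolutelyContinuousOnInterval
    ((intervalIntegrable_re hf).absolutelyContinuousOnInterval_intervalIntegral h0)
  have h2 := (lipschitzWith_ofReal.comp_absolutelyContinuousOnInterval
    ((intervalIntegrable_im hf).absolutelyContinuousOnInterval_intervalIntegral h0)).const_smul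
      Complex.I
  refine (h1.add h2).congr fun x hx => ?_
  rw [uIcc_of_le hT] at hx
  have hx' := intervalIntegrable_mono_right hf hx
  simp only [Pi.add_apply, smul_eq_mul]
  rw [← re_intervalIntegral hx', ← im_intervalIntegral hx', mul_comm]
  exact Complex.re_add_im _

namespace IsPrimitive

variable {T : ℝ} {f f' g g' : ℝ → ℂ}

theorem absolutelyContinuous (hf : IsPrimitive T f f') (hT : 0 ≤ T) :
    AbsolutelyContinuousOnInterval f 0 T :=
  ((absolutelyContinuousOnInterval_const (f 0) 0 T).add
    (absolutelyContinuousOnInterval_intervalIntegral_complex hf.1 hT)).congr fun t ht =>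
      (hf.2 t (by rwa [uIcc_of_le hT] at ht)).symm

theorem continuousOn (hf : IsPrimitive T f f') (hT : 0 ≤ T) : ContinuousOn f (Icc 0 T) := by
  simpa [uIcc_of_le hT] using (hf.absolutelyContinuous hT).continuousOn

theorem ae_hasDerivAt (hf : IsPrimitive T f f') (hT : 0 ≤ T) :
    ∀ᵐ t, t ∈ Icc (0 : ℝ) T → HasDerivAt f (f' t) t := by
  have h0 : ∀ᵐ t : ℝ, t ≠ 0 := by simp [ae_iff, measure_singleton]
  have h1 : ∀ᵐ t : ℝ, t ≠ T := by simp [ae_iff, measure_singleton]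
  filter_upwards [hf.1.ae_hasDerivAt_integral, h0, h1] with t h ht0 htT ht
  rw [uIcc_of_le hT] at h
  refine ((h ht 0 ⟨le_rfl, hT⟩).const_add (f 0)).congr_of_eventuallyEq ?_
  filter_upwards [Icc_mem_nhds (lt_of_le_of_ne ht.1 ht0.symm) (lt_of_le_of_ne ht.2 htT)] with r hr
    using hf.2 r hr

/-- The fundamental theorem of calculus for absolutely continuous complex functions. -/
theorem of_ae_hasDerivAt (hf : AbsolutelyContinuousOnInterval f 0 T) (hT : 0 ≤ T)
    (hf' : IntervalIntegrable f' volume 0 T)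
    (h : ∀ᵐ t, t ∈ Icc (0 : ℝ) T → HasDerivAt f (f' t) t) : IsPrimitive T f f' := by
  refine ⟨hf', fun t ht => ?_⟩
  have hsub : uIcc 0 t ⊆ uIcc 0 T := by
    rw [uIcc_of_le ht.1, uIcc_of_le hT]; exact Icc_subset_Icc_right ht.2
  have hft := hf.mono hsub
  have hi := intervalIntegrable_mono_right hf' ht
  rw [← sub_eq_iff_eq_add']
  apply Complex.ext
  · rw [Complex.sub_re, re_intervalIntegral hi, ← (lipschitzWith_re.comp_absolutelyContinuousOnInterval
      hft).integral_deriv_eq_sub]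
    refine intervalIntegral.integral_congr_ae ?_
    filter_upwards [h] with x hx hxt
    have := hx (by simpa [uIcc_of_le hT] using hsub (uIoc_subset_uIcc hxt))
    exact (Complex.reCLM.hasFDerivAt.comp_hasDerivAt x this).deriv
  · rw [Complex.sub_im, im_intervalIntegral hi, ← (lipschitzWith_im.comp_absolutelyContinuousOnInterval
      hft).integral_deriv_eq_sub]
    refine intervalIntegral.integral_congr_ae ?_
    filter_upwards [h] with x hx hxt
    have := hx (by simpa [uIcc_of_le hT] using hsub (uIoc_subset_uIcc hxt))
    exact (Complex.imCLM.hasFDerivAt.comp_hasDerivAt x this).deriv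

theorem mul (hf : IsPrimitive T f f') (hg : IsPrimitive T g g') (hT : 0 ≤ T) :
    IsPrimitive T (fun t => f t * g t) (fun t => f' t * g t + f t * g' t) := by
  have hfa := hf.absolutelyContinuous hT
  have hga := hg.absolutelyContinuous hT
  refine of_ae_hasDerivAt (hfa.smul hga) hT
    ((hf.1.mul_continuousOn hga.continuousOn).add (hg.1.continuousOn_mul hfa.continuousOn)) ?_
  filter_upwards [hf.ae_hasDerivAt hT, hg.ae_hasDerivAt hT] with t h1 h2 ht
    using (h1 ht).mul (h2 ht)

theorem conj (hf : IsPrimitive T f f') :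
    IsPrimitive T (fun t => (starRingEnd ℂ) (f t)) (fun t => (starRingEnd ℂ) (f' t)) := by
  refine ⟨⟨?_, ?_⟩, fun t ht => ?_⟩
  · exact Complex.conjCLE.toContinuousLinearMap.integrable_comp hf.1.1
  · exact Complex.conjCLE.toContinuousLinearMap.integrable_comp hf.1.2
  · simp only [hf.2 t ht, map_add]
    congr 1
    exact (Complex.conjCLE.toContinuousLinearMap.intervalIntegral_comp_comm
      (intervalIntegrable_mono_right hf.1 ht)).symm

theorem congr (hf : IsPrimitive T f f') (hT : 0 ≤ T) (h : EqOn f g (Icc 0 T))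
    (h' : EqOn f' g' (Icc 0 T)) : IsPrimitive T g g' := by
  refine ⟨hf.1.congr fun t ht => h' ?_, fun t ht => ?_⟩
  · exact Ioc_subset_Icc_self (by rwa [uIoc_of_le hT] at ht)
  · rw [← h ht, ← h ⟨le_rfl, hT⟩, hf.2 t ht]
    congr 1
    refine intervalIntegral.integral_congr fun r hr => h' ?_
    rw [uIcc_of_le ht.1] at hr
    exact ⟨hr.1, hr.2.trans ht.2⟩

/-- The chain rule for a Lipschitz differentiable function of a primitive. -/
theorem comp_real {s u : ℝ → ℝ} {D D' : ℝ → ℂ} {K : NNReal} (hT : 0 ≤ T)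
    (hu : IntervalIntegrable u volume 0 T) (hs : ∀ t, s t = ∫ τ in (0 : ℝ)..t, u τ)
    (hD : ∀ x, HasDerivAt D (D' x) x) (hDL : LipschitzWith K D) (hD' : Continuous D') :
    IsPrimitive T (fun t => D (s t)) (fun t => (u t : ℂ) * D' (s t)) := by
  obtain rfl : s = fun t => ∫ τ in (0 : ℝ)..t, u τ := funext hs
  have hsa := hu.absolutelyContinuousOnInterval_intervalIntegral (c := 0) left_mem_uIcc
  refine of_ae_hasDerivAt (hDL.comp_absolutelyContinuousOnInterval hsa) hT ?_ ?_
  · have : IntervalIntegrable (fun t => (u t : ℂ)) volume 0 T := ⟨hu.1.ofReal, hu.2.ofReal⟩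
    exact this.mul_continuousOn (hD'.comp_continuousOn hsa.continuousOn)
  · filter_upwards [hu.ae_hasDerivAt_integral] with t h ht
    have h1 := h (by rwa [uIcc_of_le hT]) 0 left_mem_uIcc
    simpa [Function.comp_def] using (hD _).scomp t h1

end IsPrimitive

/-! ### Weak derivatives on the unit interval -/

theorem integrableOn_mul_of_tsupport_subset {f χ : ℝ → ℝ}
    (hf : LocallyIntegrableOn f (Ioo (0 : ℝ) 1) volume) (hχ : Continuous χ)
    (hc : HasCompactSupport χ) (hs : tsupport χ ⊆ Ioo (0 : ℝ) 1) :
    IntegrableOn (fun x => f x * χ x) (Ioo (0 : ℝ) 1) volume := by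
  have h1 : IntegrableOn (fun x => f x * χ x) (tsupport χ) volume :=
    (hf.integrableOn_compact_subset hs hc).mul_continuousOn hχ.continuousOn hc
  have h2 : Function.support (fun x => f x * χ x) ⊆ tsupport χ := fun x hx =>
    subset_tsupport χ (right_ne_zero_of_mul hx)
  exact ((integrableOn_iff_integrable_of_support_subset h2).1 h1).integrableOn

theorem setIntegral_mul_eq_integral {f χ : ℝ → ℝ} (hs : tsupport χ ⊆ Ioo (0 : ℝ) 1) :
    ∫ x in Ioo (0 : ℝ) 1, f x * χ x = ∫ x, χ x * f x := by
  rw [setIntegral_eq_integral_of_forall_compl_eq_zero]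
  · simp_rw [mul_comm]
  · intro x hx
    rw [image_eq_zero_of_notMem_tsupport fun h => hx (hs h), mul_zero]

theorem integral_eq_intervalIntegral_of_tsupport_subset {χ : ℝ → ℝ}
    (hs : tsupport χ ⊆ Ioo (0 : ℝ) 1) : ∫ x, χ x = ∫ x in (0 : ℝ)..1, χ x := by
  rw [intervalIntegral.integral_of_le zero_le_one, setIntegral_eq_integral_of_forall_compl_eq_zero]
  intro x hx
  exact image_eq_zero_of_notMem_tsupport fun h => hx (Ioo_subset_Ioc_self (hs h))

/-- A test function of mean zero on `(0,1)` is the derivative of a test function. -/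
theorem exists_deriv_eq_of_integral_eq_zero {η : ℝ → ℝ} (hη : ContDiff ℝ ∞ η)
    (hc : HasCompactSupport η) (hs : tsupport η ⊆ Ioo (0 : ℝ) 1) (h0 : ∫ x, η x = 0) :
    ∃ χ : ℝ → ℝ, ContDiff ℝ ∞ χ ∧ HasCompactSupport χ ∧ tsupport χ ⊆ Ioo (0 : ℝ) 1 ∧
      deriv χ = η := by
  have hd : ∀ x, HasDerivAt (fun x => ∫ y in (0 : ℝ)..x, η y) (η x) x := fun x =>
    intervalIntegral.integral_hasDerivAt_right (hη.continuous.intervalIntegrable _ _)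
      (hη.continuous.stronglyMeasurableAtFilter _ _) hη.continuous.continuousAt
  have hderiv : deriv (fun x => ∫ y in (0 : ℝ)..x, η y) = η := funext fun x => (hd x).deriv
  obtain ⟨a, b, ha, hb, hab⟩ : ∃ a b : ℝ, 0 < a ∧ b < 1 ∧ tsupport η ⊆ Icc a b := by
    rcases (tsupport η).eq_empty_or_nonempty with he | hne
    -- `Icc 1 0` is empty, so the zero function needs no separate treatment below.
    · exact ⟨1, 0, one_pos, zero_lt_one, by simp [he]⟩
    · obtain ⟨a, ha, ha'⟩ := hc.isCompact.exists_isLeast hne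
      obtain ⟨b, hb, hb'⟩ := hc.isCompact.exists_isGreatest hne
      exact ⟨a, b, (hs ha).1, (hs hb).2, fun x hx => ⟨ha' hx, hb' hx⟩⟩
  have hzero : ∀ x, x ∉ Icc a b → η x = 0 := fun x hx =>
    image_eq_zero_of_notMem_tsupport fun h => hx (hab h)
  have hsupp : Function.support (fun x => ∫ y in (0 : ℝ)..x, η y) ⊆ Icc a b := by
    intro x hx
    by_contra hx'
    refine hx ?_
    rw [mem_Icc, not_and_or, not_le, not_le] at hx'
    rcases hx' with hxa | hxb
    · simp only
      rw [intervalIntegral.integral_congr (g := fun _ => (0 : ℝ)), intervalIntegral.integral_zero]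
      intro y hy
      refine hzero y fun hy' => ?_
      have : y < a := lt_of_le_of_lt hy.2 (max_lt ha hxa)
      linarith [hy'.1]
    · simp only
      rw [integral_eq_intervalIntegral_of_tsupport_subset hs,
        ← intervalIntegral.integral_add_adjacent_intervals (b := x)
          (hη.continuous.intervalIntegrable _ _) (hη.continuous.intervalIntegrable _ _)] at h0
      have : ∫ y in x..1, η y = 0 := by
        rw [intervalIntegral.integral_congr (g := fun _ => (0 : ℝ)), intervalIntegral.integral_zero]
        intro y hy
        refine hzero y fun hy' => ?_
        have : b < y := lt_of_lt_of_le (lt_min hxb hb) hy.1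
        linarith [hy'.2]
      linarith
  have hts : tsupport (fun x => ∫ y in (0 : ℝ)..x, η y) ⊆ Icc a b :=
    closure_minimal hsupp isClosed_Icc
  refine ⟨fun x => ∫ y in (0 : ℝ)..x, η y, ?_, ?_, ?_, hderiv⟩
  · rw [contDiff_infty_iff_deriv, hderiv]
    exact ⟨fun x => (hd x).differentiableAt, hη⟩
  · exact isCompact_Icc.of_isClosed_subset (isClosed_tsupport _) hts
  · exact hts.trans fun x hx => ⟨ha.trans_le hx.1, hx.2.trans_lt hb⟩

theorem exists_testFunction_integral_eq_one : ∃ ρ : ℝ → ℝ, ContDiff ℝ ∞ ρ ∧ HasCompactSupport ρ ∧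
    tsupport ρ ⊆ Ioo (0 : ℝ) 1 ∧ ∫ x, ρ x = 1 := by
  let B : ContDiffBump (1 / 2 : ℝ) := ⟨1 / 8, 1 / 4, by norm_num, by norm_num⟩
  refine ⟨B.normed volume, B.contDiff_normed, B.hasCompactSupport_normed, ?_, B.integral_normed⟩
  rw [B.tsupport_normed_eq, Real.closedBall_eq_Icc]
  intro x hx
  simp only [B] at hx
  constructor <;> linarith [hx.1, hx.2]

/-- The du Bois-Reymond lemma on `(0,1)`. -/
theorem exists_ae_eq_const_of_integral_mul_deriv {f : ℝ → ℝ}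
    (hf : LocallyIntegrableOn f (Ioo (0 : ℝ) 1) volume)
    (h : ∀ χ : ℝ → ℝ, ContDiff ℝ ∞ χ → HasCompactSupport χ → tsupport χ ⊆ Ioo (0 : ℝ) 1 →
      ∫ x in Ioo (0 : ℝ) 1, f x * deriv χ x = 0) :
    ∃ c : ℝ, ∀ᵐ x, x ∈ Ioo (0 : ℝ) 1 → f x = c := by
  obtain ⟨ρ, hρ, hρc, hρs, hρ1⟩ := exists_testFunction_integral_eq_one
  refine ⟨∫ x in Ioo (0 : ℝ) 1, f x * ρ x, ?_⟩
  set c := ∫ x in Ioo (0 : ℝ) 1, f x * ρ x with hcdef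
  have hconst : LocallyIntegrableOn (fun _ : ℝ => c) (Ioo (0 : ℝ) 1) volume :=
    (locallyIntegrable_const c).locallyIntegrableOn _
  have key := isOpen_Ioo.ae_eq_zero_of_integral_contDiff_smul_eq_zero (hf.sub hconst) ?_
  · filter_upwards [key] with x hx hx'
    simpa [sub_eq_zero] using hx hx'
  intro η hη hηc hηs
  have hηi := hη.continuous.integrable_of_hasCompactSupport hηc (μ := volume)
  have hρi := hρ.continuous.integrable_of_hasCompactSupport hρc (μ := volume)
  set m := ∫ x, η x with hm
  -- Subtracting `m ρ` removes the mean, so the difference is the derivative of a test function and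
  -- `f` annihilates it.
  have hζ : ContDiff ℝ ∞ (fun x => η x - m * ρ x) := hη.sub (contDiff_const.mul hρ)
  have hsub : tsupport (fun x => η x - m * ρ x) ⊆ tsupport η ∪ tsupport ρ := by
    refine closure_minimal (fun x hx => ?_) ((isClosed_tsupport _).union (isClosed_tsupport _))
    by_contra hx'
    rw [mem_union, not_or] at hx'
    exact hx (by simp [image_eq_zero_of_notMem_tsupport hx'.1,
      image_eq_zero_of_notMem_tsupport hx'.2])
  obtain ⟨χ, hχ, hχc, hχs, hχd⟩ := exists_deriv_eq_of_integral_eq_zero hζ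
    ((hηc.isCompact.union hρc.isCompact).of_isClosed_subset (isClosed_tsupport _) hsub)
    (hsub.trans (union_subset hηs hρs))
    (by rw [integral_sub hηi (hρi.const_mul m), integral_const_mul, hρ1]; simp [hm])
  have h1 := h χ hχ hχc hχs
  have hfη := integrableOn_mul_of_tsupport_subset hf hη.continuous hηc hηs
  have hfρ := integrableOn_mul_of_tsupport_subset hf hρ.continuous hρc hρs
  rw [hχd] at h1
  have h2 : ∫ x in Ioo (0 : ℝ) 1, f x * η x = m * c := by
    have e : ∫ x in Ioo (0 : ℝ) 1, (f x * η x - m * (f x * ρ x)) = 0 := by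
      refine (integral_congr_ae (Eventually.of_forall fun x => ?_)).trans h1
      simp only
      ring
    rw [integral_sub hfη (hfρ.const_mul m), integral_const_mul] at e
    linarith
  have h3 : ∫ x in Ioo (0 : ℝ) 1, c * η x = m * c := by
    rw [setIntegral_mul_eq_integral hηs, integral_mul_const]
  calc ∫ x, η x • (f x - c) = ∫ x in Ioo (0 : ℝ) 1, (f x - c) * η x := by
        rw [setIntegral_mul_eq_integral hηs]; rfl
    _ = (∫ x in Ioo (0 : ℝ) 1, f x * η x) - ∫ x in Ioo (0 : ℝ) 1, c * η x := by
        rw [← integral_sub hfη (integrableOn_mul_of_tsupport_subset hconst hη.continuous hηc hηs)]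
        congr 1; ext x; ring
    _ = 0 := by rw [h2, h3, sub_self]

theorem IsWeakDeriv.ae_eq {f g g' : ℝ → ℝ} (h : IsWeakDeriv f g) (h' : IsWeakDeriv f g') :
    ∀ᵐ x, x ∈ Ioo (0 : ℝ) 1 → g x = g' x := by
  have key := isOpen_Ioo.ae_eq_zero_of_integral_contDiff_smul_eq_zero (h.2.1.sub h'.2.1) ?_
  · filter_upwards [key] with x hx hx'
    simpa [sub_eq_zero] using hx hx'
  intro η hη hηc hηs
  have h1 := integrableOn_mul_of_tsupport_subset h.2.1 hη.continuous hηc hηs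
  have h2 := integrableOn_mul_of_tsupport_subset h'.2.1 hη.continuous hηc hηs
  calc ∫ x, η x • (g - g') x = ∫ x in Ioo (0 : ℝ) 1, (g x - g' x) * η x := by
        rw [setIntegral_mul_eq_integral hηs]; rfl
    _ = (∫ x in Ioo (0 : ℝ) 1, g x * η x) - ∫ x in Ioo (0 : ℝ) 1, g' x * η x := by
        rw [← integral_sub h1 h2]
        congr 1; ext x; ring
    _ = 0 := by
        have e1 := h.2.2 η hη hηc hηs
        have e2 := h'.2.2 η hη hηc hηs
        linarith

/-- A function with an integrable weak derivative is a primitive of it. -/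
theorem IsWeakDeriv.exists_ae_eq_integral {f g : ℝ → ℝ} (h : IsWeakDeriv f g)
    (hg : IntegrableOn g (Ioo (0 : ℝ) 1) volume) :
    ∃ c : ℝ, ∀ᵐ x, x ∈ Ioo (0 : ℝ) 1 → f x = c + ∫ y in (0 : ℝ)..x, g y := by
  have hgi : IntervalIntegrable g volume 0 1 := by
    rw [intervalIntegrable_iff_integrableOn_Ioo_of_le zero_le_one]; exact hg
  have hac := hgi.absolutelyContinuousOnInterval_intervalIntegral (c := 0) left_mem_uIcc
  have hPl : LocallyIntegrableOn (fun x => ∫ y in (0 : ℝ)..x, g y) (Ioo (0 : ℝ) 1) volume := by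
    have : ContinuousOn (fun x => ∫ y in (0 : ℝ)..x, g y) (Icc (0 : ℝ) 1) := by
      simpa using hac.continuousOn
    exact (this.mono Ioo_subset_Icc_self).locallyIntegrableOn measurableSet_Ioo
  -- Integration by parts for absolutely continuous functions shows that the primitive of `g` has
  -- weak derivative `g`, so its difference with `f` has weak derivative zero.
  obtain ⟨c, hc⟩ := exists_ae_eq_const_of_integral_mul_deriv (h.1.sub hPl) (by
    intro χ hχ hχc hχs
    have hχ' : Continuous (deriv χ) := hχ.continuous_deriv (by simp)
    have hχac : AbsolutelyContinuousOnInterval χ 0 1 :=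
      (hχ.of_le (by simp)).contDiffOn.absolutelyContinuousOnInterval
    have hs' : tsupport (deriv χ) ⊆ Ioo (0 : ℝ) 1 := tsupport_deriv_subset.trans hχs
    have h1 := integrableOn_mul_of_tsupport_subset h.1 hχ' hχc.deriv hs'
    have h2 := integrableOn_mul_of_tsupport_subset hPl hχ' hχc.deriv hs'
    have e0 : χ 0 = 0 := image_eq_zero_of_notMem_tsupport fun h => (hχs h).1.false
    have e1 : χ 1 = 0 := image_eq_zero_of_notMem_tsupport fun h => (hχs h).2.false
    have h3 := hac.integral_mul_deriv_eq_deriv_mul hχac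
    rw [e0, e1, mul_zero, mul_zero, sub_self, zero_sub,
      intervalIntegral.integral_of_le zero_le_one, ← integral_Ioc_eq_integral_Ioo.symm] at h3
    have h4 : ∫ x in (0 : ℝ)..1, deriv (fun x => ∫ y in (0 : ℝ)..x, g y) x * χ x
        = ∫ x in Ioo (0 : ℝ) 1, g x * χ x := by
      rw [← integral_Ioc_eq_integral_Ioo, ← intervalIntegral.integral_of_le zero_le_one]
      refine intervalIntegral.integral_congr_ae ?_
      filter_upwards [hgi.ae_hasDerivAt_integral] with x hx hx'
      rw [(hx (uIoc_subset_uIcc hx') 0 left_mem_uIcc).deriv]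
    rw [h4] at h3
    calc ∫ x in Ioo (0 : ℝ) 1, (f - fun x => ∫ y in (0 : ℝ)..x, g y) x * deriv χ x
        = (∫ x in Ioo (0 : ℝ) 1, f x * deriv χ x) -
          ∫ x in Ioo (0 : ℝ) 1, (∫ y in (0 : ℝ)..x, g y) * deriv χ x := by
          rw [← integral_sub h1 h2]
          congr 1; ext x; simp only [Pi.sub_apply]; ring
      _ = 0 := by rw [h.2.2 χ hχ hχc hχs, h3, sub_self])
  refine ⟨c, ?_⟩
  filter_upwards [hc] with x hx hx'
  have := hx hx'
  simp only [Pi.sub_apply] at this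
  linarith

theorem isFiniteMeasure_unitMeasure : IsFiniteMeasure unitMeasure := by
  unfold unitMeasure
  exact ⟨by simp⟩

theorem MemSobolev.memLp {m : ℕ} {f : ℝ → ℝ} (h : MemSobolev m f) : MemLp f 2 unitMeasure := by
  cases m with
  | zero => exact h
  | succ m => exact h.1

theorem MemSobolev.integrableOn {m : ℕ} {f : ℝ → ℝ} (h : MemSobolev m f) :
    IntegrableOn f (Ioo (0 : ℝ) 1) volume := by
  have := isFiniteMeasure_unitMeasure
  exact h.memLp.integrable (by norm_num)

theorem integral_eq_of_ae_eq_Ioo {f g : ℝ → ℝ} (h : ∀ᵐ x, x ∈ Ioo (0 : ℝ) 1 → f x = g x)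
    {x : ℝ} (hx : x ∈ Ioo (0 : ℝ) 1) : ∫ y in (0 : ℝ)..x, f y = ∫ y in (0 : ℝ)..x, g y := by
  refine intervalIntegral.integral_congr_ae ?_
  filter_upwards [h] with y hy hy'
  rw [uIoc_of_le hx.1.le] at hy'
  exact hy ⟨hy'.1, hy'.2.trans_lt hx.2⟩

/-- A function of class `H³` on `(0,1)` has a representative which extends to a `C²` function. -/
theorem MemSobolev.exists_smooth_representative {μ dμ : ℝ → ℝ} (hμ : MemSobolev 3 μ)
    (hdμ : IsWeakDeriv μ dμ) : ∃ W V U : ℝ → ℝ, Continuous U ∧ (∀ x, HasDerivAt W (V x) x) ∧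
      (∀ x, HasDerivAt V (U x) x) ∧ (∀ᵐ x, x ∈ Ioo (0 : ℝ) 1 → μ x = W x) ∧
      ∀ᵐ x, x ∈ Ioo (0 : ℝ) 1 → dμ x = V x := by
  obtain ⟨-, g₁, hg₁, h₁⟩ := hμ
  obtain ⟨-, g₂, hg₂, h₂⟩ := id h₁
  obtain ⟨-, g₃, hg₃, h₃⟩ := id h₂
  obtain ⟨c₀, hc₀⟩ := hg₁.exists_ae_eq_integral h₁.integrableOn
  obtain ⟨c₁, hc₁⟩ := hg₂.exists_ae_eq_integral h₂.integrableOn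
  obtain ⟨c₂, hc₂⟩ := hg₃.exists_ae_eq_integral h₃.integrableOn
  -- Extending `g₃` by zero makes the iterated primitives `U`, `V`, `W` live on all of `ℝ`, so
  -- derivatives exist at the end points too.
  have hi : Integrable ((Ioo (0 : ℝ) 1).indicator g₃) volume :=
    (integrable_indicator_iff measurableSet_Ioo).2 h₃.integrableOn
  let U : ℝ → ℝ := fun x => c₂ + ∫ y in (0 : ℝ)..x, (Ioo (0 : ℝ) 1).indicator g₃ y
  have hU : Continuous U := continuous_const.add
    (intervalIntegral.continuous_primitive (fun _ _ => hi.intervalIntegrable) 0)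
  have hprim : ∀ (c : ℝ) {f : ℝ → ℝ}, Continuous f → ∀ x,
      HasDerivAt (fun x => c + ∫ y in (0 : ℝ)..x, f y) (f x) x := fun c f hf x =>
    (intervalIntegral.integral_hasDerivAt_right (hf.intervalIntegrable _ _)
      (hf.stronglyMeasurableAtFilter _ _) hf.continuousAt).const_add c
  let V : ℝ → ℝ := fun x => c₁ + ∫ y in (0 : ℝ)..x, U y
  have hV' := hprim c₁ hU
  have hV : Continuous V := continuous_iff_continuousAt.2 fun x => (hV' x).continuousAt
  have e2 : ∀ᵐ x, x ∈ Ioo (0 : ℝ) 1 → g₂ x = U x := by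
    filter_upwards [hc₂] with x hx hx'
    rw [hx hx', integral_eq_of_ae_eq_Ioo (Eventually.of_forall fun y hy =>
      (indicator_of_mem hy g₃).symm) hx']
  have e1 : ∀ᵐ x, x ∈ Ioo (0 : ℝ) 1 → g₁ x = V x := by
    filter_upwards [hc₁] with x hx hx'
    rw [hx hx', integral_eq_of_ae_eq_Ioo e2 hx']
  refine ⟨fun x => c₀ + ∫ y in (0 : ℝ)..x, V y, V, U, hU, hprim c₀ hV, hV', ?_, ?_⟩
  · filter_upwards [hc₀] with x hx hx'
    rw [hx hx', integral_eq_of_ae_eq_Ioo e1 hx']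
  · filter_upwards [e1, hdμ.ae_eq hg₁] with x h h' hx
    rw [h' hx, h hx]

/-! ### Continuous functions as elements of `L²((0,1), ℂ)` -/

theorem memLp_of_continuous {f : ℝ → ℂ} (hf : Continuous f) : MemLp f 2 unitMeasure := by
  have := isFiniteMeasure_unitMeasure
  obtain ⟨C, hC⟩ := isCompact_Icc.exists_bound_of_continuousOn (hf.continuousOn (s := Icc (0 : ℝ) 1))
  refine MemLp.of_bound hf.aestronglyMeasurable C ?_
  rw [unitMeasure, ae_restrict_iff' measurableSet_Ioo]
  exact Eventually.of_forall fun x hx => hC x (Ioo_subset_Icc_self hx)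

/-- A continuous function as an element of `L²((0,1), ℂ)`. -/
def ofContinuous (f : ℝ → ℂ) (hf : Continuous f) : L2 := (memLp_of_continuous hf).toLp f

theorem integral_unitMeasure {E : Type*} [NormedAddCommGroup E] [NormedSpace ℝ E] (f : ℝ → E) :
    ∫ x, f x ∂unitMeasure = ∫ x in (0 : ℝ)..1, f x := by
  rw [unitMeasure, intervalIntegral.integral_of_le zero_le_one, integral_Ioc_eq_integral_Ioo]

theorem inner_ofContinuous_left {f : ℝ → ℂ} (hf : Continuous f) (g : L2) :
    ⟪ofContinuous f hf, g⟫_ℂ = ∫ x, (starRingEnd ℂ) (f x) * g x ∂unitMeasure := by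
  rw [L2.inner_def]
  refine integral_congr_ae ?_
  filter_upwards [(memLp_of_continuous hf).coeFn_toLp] with x hx
  rw [ofContinuous, hx, RCLike.inner_apply, mul_comm]

theorem inner_ofContinuous {f g : ℝ → ℂ} (hf : Continuous f) (hg : Continuous g) :
    ⟪ofContinuous f hf, ofContinuous g hg⟫_ℂ =
      ∫ x in (0 : ℝ)..1, (starRingEnd ℂ) (f x) * g x := by
  rw [inner_ofContinuous_left, ← integral_unitMeasure]
  refine integral_congr_ae ?_
  filter_upwards [(memLp_of_continuous hg).coeFn_toLp] with x hx
  rw [ofContinuous, hx]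

theorem inner_self_eq_ofReal (f : L2) : ⟪f, f⟫_ℂ = ((‖f‖ ^ 2 : ℝ) : ℂ) := by
  rw [inner_self_eq_norm_sq_to_K]; push_cast; rfl

theorem norm_sq_ofContinuous {f : ℝ → ℂ} (hf : Continuous f) :
    ‖ofContinuous f hf‖ ^ 2 = ∫ x in (0 : ℝ)..1, ‖f x‖ ^ 2 := by
  have h := inner_self_eq_ofReal (ofContinuous f hf)
  rw [inner_ofContinuous] at h
  have h2 : (fun x => (starRingEnd ℂ) (f x) * f x) = fun x => ((‖f x‖ ^ 2 : ℝ) : ℂ) := by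
    ext x; rw [Complex.conj_mul']; push_cast; rfl
  rw [h2, intervalIntegral.integral_ofReal] at h
  exact Complex.ofReal_injective h.symm

theorem ofContinuous_sub {f g : ℝ → ℂ} (hf : Continuous f) (hg : Continuous g) :
    ofContinuous f hf - ofContinuous g hg = ofContinuous (fun x => f x - g x) (hf.sub hg) :=
  ((memLp_of_continuous hf).toLp_sub (memLp_of_continuous hg)).symm

theorem norm_ofContinuous_le {f : ℝ → ℂ} (hf : Continuous f) {C : ℝ} (hC : 0 ≤ C)
    (h : ∀ x ∈ Icc (0 : ℝ) 1, ‖f x‖ ≤ C) : ‖ofContinuous f hf‖ ≤ C := by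
  refine le_of_sq_le_sq ?_ hC
  rw [norm_sq_ofContinuous hf]
  calc ∫ x in (0 : ℝ)..1, ‖f x‖ ^ 2 ≤ ∫ _ in (0 : ℝ)..1, C ^ 2 :=
        intervalIntegral.integral_mono_on zero_le_one
          ((hf.norm.pow 2).intervalIntegrable _ _) intervalIntegrable_const
          fun x hx => pow_le_pow_left₀ (norm_nonneg _) (h x hx) 2
    _ = C ^ 2 := by simp

/-- The squared distance between two states is an integral over `[0,1]` of a jointly continuous
integrand, hence continuous in the parameter. -/
theorem continuous_ofContinuous {H : ℝ → ℝ → ℂ} (hH : Continuous fun p : ℝ × ℝ => H p.1 p.2)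
    (hH' : ∀ σ, Continuous (H σ)) : Continuous fun σ => ofContinuous (H σ) (hH' σ) := by
  refine continuous_iff_continuousAt.2 fun σ₀ => ?_
  rw [ContinuousAt, tendsto_iff_norm_sub_tendsto_zero]
  have hc : Continuous fun σ => ∫ x in (0 : ℝ)..1, ‖H σ x - H σ₀ x‖ ^ 2 := by
    refine intervalIntegral.continuous_parametric_intervalIntegral_of_continuous' ?_ 0 1
    have h2 := (hH' σ₀).comp (continuous_snd (X := ℝ) (Y := ℝ))
    exact (hH.sub h2).norm.pow 2
  have h0 := (hc.sqrt.tendsto σ₀)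
  simp only [sub_self, norm_zero, ne_eq, OfNat.ofNat_ne_zero, not_false_eq_true, zero_pow,
    intervalIntegral.integral_zero, Real.sqrt_zero] at h0
  refine h0.congr fun σ => ?_
  have h1 := norm_sq_ofContinuous (f := fun x => H σ x - H σ₀ x) ((hH' σ).sub (hH' σ₀))
  rw [ofContinuous_sub, ← h1, Real.sqrt_sq (norm_nonneg _)]

/-! ### The sine basis -/

theorem continuous_eigenfun (k : ℕ+) : Continuous (eigenfun k) := by
  unfold eigenfun; fun_prop

theorem continuous_eigenfun_ofReal (k : ℕ+) : Continuous fun x => (eigenfun k x : ℂ) :=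
  Complex.continuous_ofReal.comp (continuous_eigenfun k)

theorem eigenvec_eq (k : ℕ+) :
    eigenvec k = ofContinuous (fun x => (eigenfun k x : ℂ)) (continuous_eigenfun_ofReal k) := rfl

/-- The derivative of `φ_k`. -/
def eigenfunDeriv (k : ℕ+) (x : ℝ) : ℝ :=
  Real.sqrt 2 * ((k : ℝ) * Real.pi) * Real.cos ((k : ℝ) * Real.pi * x)

theorem continuous_eigenfunDeriv (k : ℕ+) : Continuous (eigenfunDeriv k) := by
  unfold eigenfunDeriv; fun_prop

theorem hasDerivAt_eigenfun (k : ℕ+) (x : ℝ) : HasDerivAt (eigenfun k) (eigenfunDeriv k x) x := by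
  have h : HasDerivAt (fun x : ℝ => (k : ℝ) * Real.pi * x) ((k : ℝ) * Real.pi) x := by
    simpa using (hasDerivAt_id x).const_mul ((k : ℝ) * Real.pi)
  refine (h.sin.const_mul (Real.sqrt 2)).congr_deriv ?_
  unfold eigenfunDeriv; ring

theorem hasDerivAt_eigenfunDeriv (k : ℕ+) (x : ℝ) :
    HasDerivAt (eigenfunDeriv k) (-eigenvalue k * eigenfun k x) x := by
  have h : HasDerivAt (fun x : ℝ => (k : ℝ) * Real.pi * x) ((k : ℝ) * Real.pi) x := by
    simpa using (hasDerivAt_id x).const_mul ((k : ℝ) * Real.pi)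
  refine (h.cos.const_mul (Real.sqrt 2 * ((k : ℝ) * Real.pi))).congr_deriv ?_
  unfold eigenfun eigenvalue; ring

theorem eigenfun_zero (k : ℕ+) : eigenfun k 0 = 0 := by simp [eigenfun]

theorem eigenfun_one (k : ℕ+) : eigenfun k 1 = 0 := by
  simp [eigenfun, Real.sin_nat_mul_pi]

/-- Green's formula against `φ_k` for functions vanishing at the end points. -/
theorem integral_eigenfun_mul_deriv_two (k : ℕ+) {G G₁ G₂ : ℝ → ℂ}
    (h₁ : ∀ x, HasDerivAt G (G₁ x) x) (h₂ : ∀ x, HasDerivAt G₁ (G₂ x) x) (hG₂ : Continuous G₂)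
    (h0 : G 0 = 0) (h1 : G 1 = 0) :
    ∫ x in (0 : ℝ)..1, (eigenfun k x : ℂ) * G₂ x =
      -(eigenvalue k : ℂ) * ∫ x in (0 : ℝ)..1, (eigenfun k x : ℂ) * G x := by
  have hG : Continuous G := continuous_iff_continuousAt.2 fun x => (h₁ x).continuousAt
  have hφ := continuous_eigenfun_ofReal k
  -- The Wronskian vanishes at both ends because `φ_k` and `G` do; nothing is required of `G₁`
  -- there.
  have hd : ∀ x, HasDerivAt (fun x => (eigenfun k x : ℂ) * G₁ x - (eigenfunDeriv k x : ℂ) * G x)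
      ((eigenfun k x : ℂ) * G₂ x - -(eigenvalue k : ℂ) * ((eigenfun k x : ℂ) * G x)) x := by
    intro x
    refine (((hasDerivAt_eigenfun k x).ofReal_comp.mul (h₂ x)).sub
      ((hasDerivAt_eigenfunDeriv k x).ofReal_comp.mul (h₁ x))).congr_deriv ?_
    push_cast; ring
  have := intervalIntegral.integral_eq_sub_of_hasDerivAt (fun x _ => hd x)
    (Continuous.intervalIntegrable (by fun_prop) 0 1)
  rw [intervalIntegral.integral_sub (Continuous.intervalIntegrable (by fun_prop) 0 1)
    (Continuous.intervalIntegrable (by fun_prop) 0 1), intervalIntegral.integral_const_mul,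
    eigenfun_zero, eigenfun_one, h0, h1] at this
  rw [Complex.ofReal_zero] at this
  linear_combination this

theorem eigenvalue_injective : Function.Injective eigenvalue := by
  intro k l h
  unfold eigenvalue at h
  have := (sq_eq_sq₀ (by positivity) (by positivity)).1 h
  have h2 := mul_right_cancel₀ Real.pi_ne_zero this
  exact_mod_cast h2

theorem integral_eigenfun_sq (k : ℕ+) : ∫ x in (0 : ℝ)..1, eigenfun k x * eigenfun k x = 1 := by
  have hk : (2 * ((k : ℝ) * Real.pi)) ≠ 0 := by positivity
  have hd : ∀ x : ℝ, HasDerivAt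
      (fun x => x - Real.sin (2 * ((k : ℝ) * Real.pi) * x) / (2 * ((k : ℝ) * Real.pi)))
      (eigenfun k x * eigenfun k x) x := by
    intro x
    have h : HasDerivAt (fun x : ℝ => 2 * ((k : ℝ) * Real.pi) * x) (2 * ((k : ℝ) * Real.pi)) x := by
      simpa using (hasDerivAt_id x).const_mul (2 * ((k : ℝ) * Real.pi))
    refine ((hasDerivAt_id x).sub (h.sin.div_const (2 * ((k : ℝ) * Real.pi)))).congr_deriv ?_
    rw [mul_div_cancel_right₀ _ hk, mul_assoc 2, Real.cos_two_mul, eigenfun]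
    have h2 := Real.sq_sqrt (show (0 : ℝ) ≤ 2 by norm_num)
    have h3 := Real.sin_sq_add_cos_sq ((k : ℝ) * Real.pi * x)
    linear_combination -Real.sin ((k : ℝ) * Real.pi * x) ^ 2 * h2 - 2 * h3
  rw [intervalIntegral.integral_eq_sub_of_hasDerivAt (fun x _ => hd x)
    (((continuous_eigenfun k).mul (continuous_eigenfun k)).intervalIntegrable 0 1)]
  have : Real.sin (2 * ((k : ℝ) * Real.pi)) = 0 := by
    have := Real.sin_nat_mul_pi (2 * (k : ℕ))
    push_cast at this
    rw [← mul_assoc]; exact this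
  simp [this]

/-- Green's formula applied to `φ_l` gives `(λ_k - λ_l) ⟨φ_k, φ_l⟩ = 0`, and the eigenvalues are
distinct. -/
theorem orthonormal_eigenvec : Orthonormal ℂ eigenvec := by
  rw [orthonormal_iff_ite]
  intro k l
  rw [eigenvec_eq, eigenvec_eq, inner_ofContinuous]
  simp only [Complex.conj_ofReal]
  split_ifs with h
  · subst h
    have := integral_eigenfun_sq k
    have e : ∫ x in (0 : ℝ)..1, (eigenfun k x : ℂ) * (eigenfun k x : ℂ)
        = ((∫ x in (0 : ℝ)..1, eigenfun k x * eigenfun k x : ℝ) : ℂ) := by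
      rw [← intervalIntegral.integral_ofReal]; simp
    rw [e, this, Complex.ofReal_one]
  · have hg := integral_eigenfun_mul_deriv_two k (fun x => (hasDerivAt_eigenfun l x).ofReal_comp)
      (fun x => (hasDerivAt_eigenfunDeriv l x).ofReal_comp)
      (Complex.continuous_ofReal.comp (continuous_const.mul (continuous_eigenfun l)))
      (by simp [eigenfun_zero]) (by simp [eigenfun_one])
    have e : ∀ x, (eigenfun k x : ℂ) * ((-eigenvalue l * eigenfun l x : ℝ) : ℂ) =
      -(eigenvalue l : ℂ) * ((eigenfun k x : ℂ) * (eigenfun l x : ℂ)) := fun x => by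
        push_cast; ring
    simp only [e, intervalIntegral.integral_const_mul] at hg
    have hne : (eigenvalue k : ℂ) - eigenvalue l ≠ 0 := by
      rw [sub_ne_zero]
      exact_mod_cast fun h' => h (eigenvalue_injective h')
    refine (mul_eq_zero.1 ?_).resolve_left hne
    linear_combination hg

theorem coeff_eq_integral (f : L2) (k : ℕ+) :
    coeff f k = ∫ x, (eigenfun k x : ℂ) * f x ∂unitMeasure := by
  rw [coeff, eigenvec_eq, inner_ofContinuous_left]
  simp only [Complex.conj_ofReal]

theorem fourier_two_coe (n : ℤ) (x : ℝ) :
    fourier n (x : AddCircle ((1 : ℝ) - -1)) = Complex.exp (Real.pi * n * x * Complex.I) := by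
  rw [fourier_coe_apply]
  congr 1
  push_cast
  ring

/-- The sine system is complete. -/
theorem eq_zero_of_coeff_eq_zero {f : L2} (h : ∀ k, coeff f k = 0) : f = 0 := by
  have hsin : ∀ n : ℤ, ∫ x, (Real.sin (n * Real.pi * x) : ℂ) * f x ∂unitMeasure = 0 := by
    have hpos : ∀ n : ℕ, ∫ x, (Real.sin (n * Real.pi * x) : ℂ) * f x ∂unitMeasure = 0 := by
      intro n
      rcases Nat.eq_zero_or_pos n with rfl | hn
      · simp
      · have hk := h ⟨n, hn⟩
        rw [coeff_eq_integral f ⟨n, hn⟩] at hk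
        simp only [eigenfun, PNat.mk_coe, Complex.ofReal_mul, mul_assoc] at hk
        rw [integral_const_mul] at hk
        have h2 : ((Real.sqrt 2 : ℝ) : ℂ) ≠ 0 := by simp
        simpa [mul_assoc] using (mul_eq_zero.1 hk).resolve_left h2
    intro n
    obtain ⟨m, rfl | rfl⟩ := n.eq_nat_or_neg
    · exact_mod_cast hpos m
    · have : ∀ x : ℝ, (Real.sin ((-(m : ℤ) : ℤ) * Real.pi * x) : ℂ) * f x =
          -((Real.sin (m * Real.pi * x) : ℂ) * f x) := fun x => by
        push_cast
        rw [neg_mul, neg_mul, Complex.sin_neg, neg_mul]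
      simp only [this, integral_neg, hpos m, neg_zero]
  -- The odd extension `F(x) - F(-x)` to `(-1,1)` has Fourier coefficients proportional to the sine
  -- integrals of `f`. They all vanish, and Parseval on the circle of length 2 concludes.
  let F : ℝ → ℂ := (Ioo (0 : ℝ) 1).indicator f
  have hF : MemLp F 2 volume := (memLp_indicator_iff_restrict measurableSet_Ioo).2 (Lp.memLp f)
  have hFn : MemLp (fun x => F (-x)) 2 volume :=
    hF.comp_measurePreserving (Measure.measurePreserving_neg volume)
  have hF1 : Integrable F volume := by
    rw [integrable_indicator_iff measurableSet_Ioo]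
    have := isFiniteMeasure_unitMeasure
    exact (Lp.memLp f).integrable (by norm_num)
  have hodd : MemLp (fun x => F x - F (-x)) 2 (volume.restrict (Ioc (-1 : ℝ) 1)) :=
    (hF.sub hFn).restrict _
  have hcoef : ∀ n : ℤ, fourierCoeffOn (by norm_num : (-1 : ℝ) < 1)
      (fun x => F x - F (-x)) n = 0 := by
    intro n
    rw [fourierCoeffOn_eq_integral]
    simp only [fourier_two_coe, smul_eq_mul]
    set e : ℝ → ℂ := fun x => Complex.exp (Real.pi * (-n : ℤ) * x * Complex.I) with he
    have hec : Continuous e := by fun_prop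
    have hec' : Continuous fun x => e (-x) := hec.comp continuous_neg
    have hFi : ∀ a b : ℝ, IntervalIntegrable F volume a b := fun a b => hF1.intervalIntegrable
    have hFni : ∀ a b : ℝ, IntervalIntegrable (fun x => F (-x)) volume a b := fun a b =>
      hF1.comp_neg.intervalIntegrable
    have h1 : ∫ x in (-1 : ℝ)..1, e x * (F x - F (-x)) =
        ∫ x in (-1 : ℝ)..1, (e x - e (-x)) * F x := by
      have h2 : ∫ x in (-1 : ℝ)..1, e x * F (-x) = ∫ x in (-1 : ℝ)..1, e (-x) * F x := by
        have := intervalIntegral.integral_comp_neg (a := -1) (b := 1) (fun x => e (-x) * F x)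
        simpa using this
      simp only [mul_sub, sub_mul]
      rw [intervalIntegral.integral_sub ((hFi _ _).continuousOn_mul hec.continuousOn)
        ((hFni _ _).continuousOn_mul hec.continuousOn),
        intervalIntegral.integral_sub ((hFi _ _).continuousOn_mul hec.continuousOn)
        ((hFi _ _).continuousOn_mul hec'.continuousOn), h2]
    have h3 : ∀ x, e x - e (-x) = -2 * Complex.I * (Real.sin (n * Real.pi * x) : ℂ) := by
      intro x
      have e1 : e x = Complex.exp (-(n * Real.pi * x) * Complex.I) := by
        simp only [he]; congr 1; push_cast; ring
      have e2 : e (-x) = Complex.exp (n * Real.pi * x * Complex.I) := by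
        simp only [he]; congr 1; push_cast; ring
      rw [e1, e2]
      push_cast
      rw [Complex.sin]
      linear_combination (Complex.exp (-(n * Real.pi * x) * Complex.I) -
        Complex.exp (n * Real.pi * x * Complex.I)) * Complex.I_sq
    have h4 : ∫ x in (-1 : ℝ)..1, (e x - e (-x)) * F x = 0 := by
      rw [intervalIntegral.integral_of_le (by norm_num)]
      have h5 : ∀ x, (e x - e (-x)) * F x = (Ioo (0 : ℝ) 1).indicator
          (fun x => -2 * Complex.I * ((Real.sin (n * Real.pi * x) : ℂ) * f x)) x := by
        intro x
        rw [h3]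
        by_cases hx : x ∈ Ioo (0 : ℝ) 1
        · simp only [F, indicator_of_mem hx]; ring
        · simp only [F, indicator_of_notMem hx, mul_zero]
      simp only [h5]
      rw [setIntegral_indicator measurableSet_Ioo, inter_eq_right.2
        ((Ioo_subset_Ioo_left (by norm_num)).trans Ioo_subset_Ioc_self), integral_const_mul]
      have := hsin n
      rw [show ∫ x in Ioo (0 : ℝ) 1, (Real.sin (n * Real.pi * x) : ℂ) * f x = 0 from this, mul_zero]
    rw [h1, h4, smul_zero]
  have hpars := tsum_sq_fourierCoeffOn (by norm_num : (-1 : ℝ) < 1) hodd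
  simp only [hcoef, norm_zero, ne_eq, OfNat.ofNat_ne_zero, not_false_eq_true, zero_pow,
    tsum_zero] at hpars
  have hint : ∫ x in Ioc (-1 : ℝ) 1, ‖F x - F (-x)‖ ^ 2 = 0 := by
    rw [intervalIntegral.integral_of_le (by norm_num)] at hpars
    have : ((1 : ℝ) - -1)⁻¹ ≠ 0 := by norm_num
    exact (smul_eq_zero.1 hpars.symm).resolve_left this
  rw [integral_eq_zero_iff_of_nonneg (fun x => by positivity) hodd.integrable_norm_pow'] at hint
  rw [Lp.eq_zero_iff_ae_eq_zero]
  change f =ᵐ[volume.restrict (Ioo (0 : ℝ) 1)] 0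
  rw [Filter.EventuallyEq, ae_restrict_iff' measurableSet_Ioc] at hint
  rw [Filter.EventuallyEq, ae_restrict_iff' measurableSet_Ioo]
  filter_upwards [hint] with x hx hx'
  have h1 := hx ⟨by linarith [hx'.1], hx'.2.le⟩
  have h2 : F (-x) = 0 := indicator_of_notMem (fun h => by linarith [h.1, hx'.1]) _
  have h3 : F x = f x := indicator_of_mem hx' _
  simpa [h2, h3] using h1

/-- The sine basis of `L²((0,1), ℂ)`. -/
def sineBasis : HilbertBasis ℕ+ ℂ L2 :=
  HilbertBasis.mkOfOrthogonalEqBot orthonormal_eigenvec <| by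
    rw [Submodule.eq_bot_iff]
    intro f hf
    refine eq_zero_of_coeff_eq_zero fun k => ?_
    exact (Submodule.mem_orthogonal _ _).1 hf _ (Submodule.subset_span ⟨k, rfl⟩)

theorem sineBasis_apply (k : ℕ+) : sineBasis k = eigenvec k := by
  rw [sineBasis, HilbertBasis.coe_mkOfOrthogonalEqBot]

theorem conj_coeff (f : L2) (k : ℕ+) : (starRingEnd ℂ) (coeff f k) = ⟪f, eigenvec k⟫_ℂ :=
  inner_conj_symm f (eigenvec k)

/-- Parseval's identity. -/
theorem hasSum_conj_coeff_mul_coeff (f g : L2) :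
    HasSum (fun k => (starRingEnd ℂ) (coeff f k) * coeff g k) ⟪f, g⟫_ℂ := by
  simp only [conj_coeff]
  simp only [coeff]
  simpa only [sineBasis_apply] using sineBasis.hasSum_inner_mul_inner f g

theorem hasSum_norm_coeff_sq (f : L2) : HasSum (fun k => ‖coeff f k‖ ^ 2) (‖f‖ ^ 2) := by
  have h := hasSum_conj_coeff_mul_coeff f f
  rw [inner_self_eq_ofReal] at h
  simp only [Complex.conj_mul'] at h
  exact_mod_cast h

/-- A Cauchy-Schwarz inequality for finitely many coefficients. -/
theorem sum_norm_coeff_mul_le (f g : L2) (S : Finset ℕ+) :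
    ∑ k ∈ S, ‖coeff f k‖ * ‖coeff g k‖ ≤ ‖f‖ * ‖g‖ := by
  refine (Real.sum_mul_le_sqrt_mul_sqrt S _ _).trans ?_
  have h : ∀ f : L2, √(∑ k ∈ S, ‖coeff f k‖ ^ 2) ≤ ‖f‖ := fun f =>
    Real.sqrt_le_iff.2 ⟨norm_nonneg _, orthonormal_eigenvec.sum_inner_products_le f⟩
  exact mul_le_mul (h f) (h g) (Real.sqrt_nonneg _) (norm_nonneg _)

/-! ### Multiplication by the potential -/

/-- `W` is bounded on `[0,1]`, so every product is in `L²` and the default branch of `mulPot` never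
occurs; symmetry holds because `μ` is real. The last clause makes the operator explicit on gauged
states. -/
theorem exists_mulPot_clm {μ W : ℝ → ℝ} (hW : Continuous W)
    (h : ∀ᵐ x, x ∈ Ioo (0 : ℝ) 1 → μ x = W x) :
    ∃ M : L2 →L[ℂ] L2, (∀ f, mulPot μ f = M f) ∧ (∀ f g, ⟪M f, g⟫_ℂ = ⟪f, M g⟫_ℂ) ∧
      ∀ (f : ℝ → ℂ) (hf : Continuous f), M (ofContinuous f hf) =
        ofContinuous (fun x => (W x : ℂ) * f x) ((Complex.continuous_ofReal.comp hW).mul hf) := by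
  have h' : ∀ᵐ x ∂unitMeasure, μ x = W x := by
    rw [unitMeasure, ae_restrict_iff' measurableSet_Ioo]; exact h
  obtain ⟨C, hC⟩ := isCompact_Icc.exists_bound_of_continuousOn (hW.continuousOn (s := Icc (0 : ℝ) 1))
  have hWC : ∀ᵐ x ∂unitMeasure, ‖(W x : ℂ)‖ ≤ C := by
    rw [unitMeasure, ae_restrict_iff' measurableSet_Ioo]
    exact Eventually.of_forall fun x hx => by
      rw [Complex.norm_real]; exact hC x (Ioo_subset_Icc_self hx)
  have hmem : ∀ f : L2, MemLp (fun x => (μ x : ℂ) * f x) 2 unitMeasure := by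
    intro f
    have h1 : MemLp (fun x => (W x : ℂ) * f x) 2 unitMeasure := by
      refine (Lp.memLp f).of_le_mul (c := C) ?_ ?_
      · exact (Complex.continuous_ofReal.comp hW).aestronglyMeasurable.mul
          (Lp.aestronglyMeasurable f)
      · filter_upwards [hWC] with x hx
        rw [norm_mul]
        gcongr
    refine h1.ae_eq ?_
    filter_upwards [h'] with x hx
    rw [hx]
  have hcoe : ∀ f : L2, mulPot μ f =ᵐ[unitMeasure] fun x => (W x : ℂ) * f x := by
    intro f
    rw [mulPot, dif_pos (hmem f)]
    filter_upwards [(hmem f).coeFn_toLp, h'] with x hx hx'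
    rw [hx, hx']
  let L : L2 →ₗ[ℂ] L2 :=
    { toFun := mulPot μ
      map_add' := fun f g => by
        apply Lp.ext
        filter_upwards [hcoe f, hcoe g, hcoe (f + g), Lp.coeFn_add f g,
          Lp.coeFn_add (mulPot μ f) (mulPot μ g)] with x h1 h2 h3 h4 h5
        rw [h3, h4, h5, Pi.add_apply, Pi.add_apply, h1, h2, mul_add]
      map_smul' := fun c f => by
        apply Lp.ext
        filter_upwards [hcoe f, hcoe (c • f), Lp.coeFn_smul c f,
          Lp.coeFn_smul c (mulPot μ f)] with x h1 h2 h3 h4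
        rw [h2, h3, RingHom.id_apply, h4, Pi.smul_apply, Pi.smul_apply, h1, smul_eq_mul,
          smul_eq_mul]
        ring }
  refine ⟨L.mkContinuous C fun f => ?_, fun f => rfl, fun f g => ?_, fun f hf => ?_⟩
  · refine Lp.norm_le_mul_norm_of_ae_le_mul ?_
    filter_upwards [hcoe f, hWC] with x hx hx'
    rw [show (L f : ℝ → ℂ) x = _ from hx, norm_mul]
    gcongr
  · rw [L2.inner_def, L2.inner_def]
    refine integral_congr_ae ?_
    filter_upwards [hcoe f, hcoe g] with x h1 h2
    rw [show (L.mkContinuous C _ f : ℝ → ℂ) x = _ from h1,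
      show (L.mkContinuous C _ g : ℝ → ℂ) x = _ from h2, RCLike.inner_apply, RCLike.inner_apply,
      map_mul, Complex.conj_ofReal]
    ring
  · apply Lp.ext
    filter_upwards [hcoe (ofContinuous f hf), (memLp_of_continuous hf).coeFn_toLp,
      (memLp_of_continuous ((Complex.continuous_ofReal.comp hW).mul hf)).coeFn_toLp] with x h1 h2 h3
    rw [show (L.mkContinuous C _ (ofContinuous f hf) : ℝ → ℂ) x = _ from h1, ofContinuous, h2]
    exact h3.symm

/-! ### The free group -/

/-- The coefficient functional as a continuous linear map. -/
def coeffCLM (k : ℕ+) : L2 →L[ℂ] ℂ := innerSL ℂ (eigenvec k)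

theorem coeffCLM_apply (k : ℕ+) (f : L2) : coeffCLM k f = coeff f k := rfl

theorem coeff_eigenvec (k l : ℕ+) : coeff (eigenvec l) k = if k = l then 1 else 0 :=
  orthonormal_iff_ite.1 orthonormal_eigenvec k l

theorem norm_coeff_le (f : L2) (k : ℕ+) : ‖coeff f k‖ ≤ ‖f‖ := by
  have := norm_inner_le_norm (𝕜 := ℂ) (eigenvec k) f
  rwa [orthonormal_eigenvec.1 k, one_mul] at this

theorem norm_exp_freeGroup (k : ℕ+) (t : ℝ) :
    ‖Complex.exp (-Complex.I * (eigenvalue k : ℂ) * (t : ℂ))‖ = 1 := by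
  rw [show -Complex.I * (eigenvalue k : ℂ) * (t : ℂ) = ((-(eigenvalue k * t) : ℝ) : ℂ) * Complex.I by
    push_cast; ring]
  exact Complex.norm_exp_ofReal_mul_I _

theorem hasSum_freeGroup (t : ℝ) (f : L2) :
    HasSum (fun k : ℕ+ => (Complex.exp (-Complex.I * (eigenvalue k : ℂ) * (t : ℂ)) * coeff f k) •
      eigenvec k) (freeGroup t f) := by
  refine Summable.hasSum ?_
  have h := orthonormal_eigenvec.orthogonalFamily.summable_iff_norm_sq_summable
    (fun k : ℕ+ => Complex.exp (-Complex.I * (eigenvalue k : ℂ) * (t : ℂ)) * coeff f k)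
  refine h.2 ?_
  simp only [norm_mul, norm_exp_freeGroup, one_mul]
  exact (hasSum_norm_coeff_sq f).summable

theorem coeff_freeGroup (t : ℝ) (f : L2) (k : ℕ+) :
    coeff (freeGroup t f) k =
      Complex.exp (-Complex.I * (eigenvalue k : ℂ) * (t : ℂ)) * coeff f k := by
  have h := (hasSum_freeGroup t f).mapL (coeffCLM k)
  have h2 := hasSum_single (f := fun l => coeffCLM k
    ((Complex.exp (-Complex.I * (eigenvalue l : ℂ) * (t : ℂ)) * coeff f l) • eigenvec l)) k
    (fun l hl => by simp [coeffCLM_apply, coeff_eigenvec, hl.symm])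
  rw [← coeffCLM_apply, h.unique h2, map_smul, coeffCLM_apply, coeff_eigenvec]
  simp

theorem norm_freeGroup (t : ℝ) (f : L2) : ‖freeGroup t f‖ = ‖f‖ := by
  have h := hasSum_norm_coeff_sq (freeGroup t f)
  simp only [coeff_freeGroup, norm_mul, norm_exp_freeGroup, one_mul] at h
  have := h.unique (hasSum_norm_coeff_sq f)
  exact (sq_eq_sq₀ (norm_nonneg _) (norm_nonneg _)).1 this

/-- The group preserves norms, so only measurability is at stake. It follows from pointwise
convergence of the partial spectral sums; strong continuity of the group is not needed. -/
theorem intervalIntegrable_freeGroup {g : ℝ → L2} {a b t : ℝ}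
    (hg : IntervalIntegrable g volume a b) :
    IntervalIntegrable (fun τ => freeGroup (t - τ) (g τ)) volume a b := by
  have key : ∀ ν : Measure ℝ, Integrable g ν → Integrable (fun τ => freeGroup (t - τ) (g τ)) ν := by
    intro ν hν
    refine hν.mono ?_ (Eventually.of_forall fun τ => (norm_freeGroup _ _).le)
    refine aestronglyMeasurable_of_tendsto_ae (atTop : Filter (Finset ℕ+)) (fun S => ?_)
      (Eventually.of_forall fun τ => hasSum_freeGroup (t - τ) (g τ))
    refine Finset.aestronglyMeasurable_fun_sum S fun k _ => ?_
    refine AEStronglyMeasurable.smul_const (AEStronglyMeasurable.mul ?_ ?_) _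
    · exact Continuous.aestronglyMeasurable (by fun_prop)
    · exact (coeffCLM k).continuous.comp_aestronglyMeasurable hν.1
  exact ⟨key _ hg.1, key _ hg.2⟩

/-! ### Solutions in the interaction picture -/

theorem norm_le_normHzero {s : ℕ} {f : L2} (hf : MemHzero s f) : ‖f‖ ≤ normHzero s f := by
  refine Real.le_sqrt_of_sq_le ?_
  refine hasSum_le (fun k => ?_) (hasSum_norm_coeff_sq f) hf.hasSum
  rw [norm_mul]
  have h1 : (1 : ℝ) ≤ ‖((k : ℂ) ^ s)‖ := by
    rw [norm_pow]
    refine one_le_pow₀ ?_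
    have : (1 : ℝ) ≤ (k : ℕ) := by exact_mod_cast k.pos
    simpa using this
  gcongr
  exact le_mul_of_one_le_left (norm_nonneg _) h1

theorem MemHzero.sub {s : ℕ} {f g : L2} (hf : MemHzero s f) (hg : MemHzero s g) :
    MemHzero s (f - g) := by
  refine Summable.of_nonneg_of_le (fun k => by positivity) (fun k => ?_)
    ((Summable.mul_left 2 hf).add (Summable.mul_left 2 hg))
  rw [← coeffCLM_apply, map_sub, coeffCLM_apply, coeffCLM_apply, mul_sub]
  have h1 := norm_sub_le ((k : ℂ) ^ s * coeff f k) ((k : ℂ) ^ s * coeff g k)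
  have h2 := norm_nonneg ((k : ℂ) ^ s * coeff f k - (k : ℂ) ^ s * coeff g k)
  nlinarith [sq_nonneg (‖(k : ℂ) ^ s * coeff f k‖ - ‖(k : ℂ) ^ s * coeff g k‖)]

theorem ContHzero.continuousOn {s : ℕ} {T : ℝ} {ψ : ℝ → L2} (h : ContHzero s T ψ) :
    ContinuousOn ψ (Icc 0 T) := by
  intro t₀ ht₀
  rw [ContinuousWithinAt, tendsto_iff_norm_sub_tendsto_zero]
  refine squeeze_zero' (Eventually.of_forall fun _ => norm_nonneg _) ?_ (h.2 t₀ ht₀)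
  filter_upwards [self_mem_nhdsWithin] with t ht
  exact norm_le_normHzero ((h.1 t ht).sub (h.1 t₀ ht₀))

/-- `y` solves, coefficient by coefficient, the Schrödinger equation
`i y' = (A - λ_j) y - u M y` on `[0,T]`, with `y(0) = φ_j`. -/
structure SolvesModes (M : L2 →L[ℂ] L2) (u : ℝ → ℝ) (T : ℝ) (j : ℕ+) (y : ℝ → L2) : Prop where
  continuousOn : ContinuousOn y (Icc 0 T)
  initial : y 0 = eigenvec j
  modes : ∀ k, IsPrimitive T (fun t => coeff (y t) k) fun t => Complex.I *
    (((eigenvalue j : ℂ) - eigenvalue k) * coeff (y t) k + u t * coeff (M (y t)) k)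

theorem IsPrimitive.of_hasDerivAt {T : ℝ} {f f' : ℝ → ℂ} (h : ∀ t, HasDerivAt f (f' t) t)
    (hf' : Continuous f') : IsPrimitive T f f' := by
  refine ⟨hf'.intervalIntegrable _ _, fun t _ => ?_⟩
  rw [intervalIntegral.integral_eq_sub_of_hasDerivAt (fun x _ => h x) (hf'.intervalIntegrable _ _)]
  ring

theorem intervalIntegrable_ofReal {u : ℝ → ℝ} {a b : ℝ} (hu : IntervalIntegrable u volume a b) :
    IntervalIntegrable (fun t => (u t : ℂ)) volume a b :=
  ⟨hu.1.ofReal, hu.2.ofReal⟩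

theorem freeGroup_zero (f : L2) : freeGroup 0 f = f := by
  rw [← sub_eq_zero]
  refine eq_zero_of_coeff_eq_zero fun k => ?_
  rw [← coeffCLM_apply, map_sub, coeffCLM_apply, coeffCLM_apply, coeff_freeGroup]
  simp

/-- Projecting Duhamel's formula on one mode and factoring out the free oscillation leaves an
integrand independent of `t`, to which the calculus of primitives applies. -/
theorem IsWeakSolution.coeff_eq {μ u : ℝ → ℝ} {T : ℝ} {ψ₀ : L2} {ψ : ℝ → L2}
    (h : IsWeakSolution μ u T ψ₀ ψ) {M : L2 →L[ℂ] L2} (hM : ∀ f, mulPot μ f = M f)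
    (hu : IntervalIntegrable u volume 0 T) (k : ℕ+) {t : ℝ} (ht : t ∈ Icc 0 T) :
    coeff (ψ t) k = Complex.exp (-Complex.I * (eigenvalue k : ℂ) * (t : ℂ)) * (coeff ψ₀ k +
      ∫ τ in (0 : ℝ)..t, Complex.exp (Complex.I * (eigenvalue k : ℂ) * (τ : ℂ)) *
        (Complex.I * (u τ * coeff (M (ψ τ)) k))) := by
  have hψ := h.1.continuousOn.mono (Icc_subset_Icc_right ht.2)
  have hg : IntervalIntegrable (fun τ => (u τ : ℂ) • mulPot μ (ψ τ)) volume 0 t := by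
    simp only [hM]
    refine (intervalIntegrable_ofReal (intervalIntegrable_mono_right hu ht)).smul_continuousOn ?_
    rw [uIcc_of_le ht.1]
    exact M.continuous.comp_continuousOn hψ
  have e : coeffCLM k (ψ t) = _ := congrArg (coeffCLM k) (h.2 t ht)
  rw [map_add, map_smul, ← (coeffCLM k).intervalIntegral_comp_comm
    (intervalIntegrable_freeGroup (t := t) hg)] at e
  simp only [coeffCLM_apply, coeff_freeGroup, smul_eq_mul] at e
  rw [e, mul_add, ← intervalIntegral.integral_const_mul, ← intervalIntegral.integral_const_mul]
  congr 1
  refine intervalIntegral.integral_congr fun τ _ => ?_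
  rw [← coeffCLM_apply, map_smul, coeffCLM_apply, hM, smul_eq_mul,
    show -Complex.I * (eigenvalue k : ℂ) * ((t - τ : ℝ) : ℂ) = -Complex.I * (eigenvalue k : ℂ) *
      (t : ℂ) + Complex.I * (eigenvalue k : ℂ) * (τ : ℂ) by push_cast; ring, Complex.exp_add]
  ring

theorem IsWeakSolution.solvesModes {μ u : ℝ → ℝ} {T : ℝ} {j : ℕ+} {ψ : ℝ → L2}
    (h : IsWeakSolution μ u T (eigenvec j) ψ) {M : L2 →L[ℂ] L2} (hM : ∀ f, mulPot μ f = M f)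
    (hu : IntervalIntegrable u volume 0 T) (hT : 0 ≤ T) :
    SolvesModes M u T j
      fun t => Complex.exp (Complex.I * (eigenvalue j : ℂ) * (t : ℂ)) • ψ t where
  continuousOn := by
    have hc : Continuous fun t : ℝ => Complex.exp (Complex.I * (eigenvalue j : ℂ) * (t : ℂ)) := by
      fun_prop
    exact hc.continuousOn.smul h.1.continuousOn
  initial := by
    have := h.2 0 ⟨le_rfl, hT⟩
    rw [intervalIntegral.integral_same, smul_zero, add_zero, freeGroup_zero] at this
    simp [this]
  modes := by
    intro k
    have hψ := h.1.continuousOn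
    -- The coefficient of `y` is `e^{wt}` times the primitive in Duhamel's formula, so the product
    -- rule gives its equation.
    set w : ℂ := Complex.I * ((eigenvalue j : ℂ) - eigenvalue k) with hw
    have h1 : IsPrimitive T (fun t : ℝ => Complex.exp (w * t))
        (fun t : ℝ => w * Complex.exp (w * t)) := by
      refine IsPrimitive.of_hasDerivAt (fun t => ?_) (by fun_prop)
      have h2 : HasDerivAt (fun t : ℝ => w * (t : ℂ)) w t := by
        simpa using (Complex.ofRealCLM.hasDerivAt (x := t)).const_mul w
      simpa [mul_comm] using h2.cexp
    have h2 : IsPrimitive T (fun t : ℝ => coeff (eigenvec j) k +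
        ∫ τ in (0 : ℝ)..t, Complex.exp (Complex.I * (eigenvalue k : ℂ) * (τ : ℂ)) *
          (Complex.I * (u τ * coeff (M (ψ τ)) k)))
        (fun τ : ℝ => Complex.exp (Complex.I * (eigenvalue k : ℂ) * (τ : ℂ)) *
          (Complex.I * (u τ * coeff (M (ψ τ)) k))) := by
      refine ⟨?_, fun t _ => by simp⟩
      have hc : ContinuousOn (fun τ => coeff (M (ψ τ)) k) (uIcc 0 T) := by
        rw [uIcc_of_le hT]
        exact (coeffCLM k).continuous.comp_continuousOn (M.continuous.comp_continuousOn hψ)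
      exact (((intervalIntegrable_ofReal hu).mul_continuousOn hc).const_mul _).continuousOn_mul
        (Continuous.continuousOn (by fun_prop))
    refine (h1.mul h2 hT).congr hT (fun t ht => ?_) (fun t ht => ?_)
    · simp only
      rw [← coeffCLM_apply k (_ • _), map_smul, coeffCLM_apply, h.coeff_eq hM hu k ht, smul_eq_mul,
        ← mul_assoc, ← Complex.exp_add]
      congr 2
      rw [hw]; ring
    · simp only
      rw [← coeffCLM_apply k (_ • _), map_smul, coeffCLM_apply, map_smul, ← coeffCLM_apply k (_ • _),
        map_smul, coeffCLM_apply, smul_eq_mul, smul_eq_mul, h.coeff_eq hM hu k ht]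
      have e1 : Complex.exp (w * t) = Complex.exp (Complex.I * (eigenvalue j : ℂ) * (t : ℂ)) *
          Complex.exp (-Complex.I * (eigenvalue k : ℂ) * (t : ℂ)) := by
        rw [← Complex.exp_add, hw]; congr 1; ring
      have e2 : Complex.exp (-Complex.I * (eigenvalue k : ℂ) * (t : ℂ)) *
          Complex.exp (Complex.I * (eigenvalue k : ℂ) * (t : ℂ)) = 1 := by
        rw [← Complex.exp_add]; simp
      rw [e1, hw]
      linear_combination Complex.exp (Complex.I * (eigenvalue j : ℂ) * (t : ℂ)) *
          (Complex.I * (u t * coeff (M (ψ t)) k)) * e2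

/-! ### Duality -/

variable {M : L2 →L[ℂ] L2} {u : ℝ → ℝ} {T : ℝ} {j : ℕ+} {y : ℝ → L2}

/-- The evolution of the scalar product of a solution with a solution of the dual equation with
source `F`. -/
theorem SolvesModes.inner_eq (hy : SolvesModes M u T j y) (hM : ∀ f g, ⟪M f, g⟫_ℂ = ⟪f, M g⟫_ℂ)
    (hu : IntervalIntegrable u volume 0 T) (hT : 0 ≤ T) {g F : ℝ → L2} {q : ℕ+ → ℝ → ℂ}
    (hg : ContinuousOn g (Icc 0 T)) (hF : ContinuousOn F (Icc 0 T))
    (hgq : ∀ k, IsPrimitive T (fun t => coeff (g t) k)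
      fun t => Complex.I * (q k t + u t * coeff (M (g t)) k))
    (hq : ∀ k, ∀ t ∈ Icc 0 T,
      ((eigenvalue j : ℂ) - eigenvalue k) * coeff (g t) k - q k t = coeff (F t) k)
    {t : ℝ} (ht : t ∈ Icc 0 T) :
    ⟪g t, y t⟫_ℂ = ⟪g 0, y 0⟫_ℂ + Complex.I * ∫ τ in (0 : ℝ)..t, ⟪F τ, y τ⟫_ℂ := by
  have hyc := hy.continuousOn
  -- The unbounded factors `λ_j - λ_k` are merged into the coefficient of `F` mode by mode, before
  -- summation, so that no domain question arises for `y` or `g`.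
  let Z : ℕ+ → ℝ → ℂ := fun k t => Complex.I * ((starRingEnd ℂ) (coeff (F t) k) * coeff (y t) k +
    u t * ((starRingEnd ℂ) (coeff (g t) k) * coeff (M (y t)) k -
      (starRingEnd ℂ) (coeff (M (g t)) k) * coeff (y t) k))
  have hZ : ∀ k, IsPrimitive T (fun t => (starRingEnd ℂ) (coeff (g t) k) * coeff (y t) k) (Z k) := by
    intro k
    refine ((hgq k).conj.mul (hy.modes k) hT).congr hT (fun t _ => rfl) fun t ht => ?_
    simp only [Z]
    rw [← hq k t ht]
    simp only [map_mul, map_add, map_sub, Complex.conj_I, Complex.conj_ofReal]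
    ring
  have hsub : Icc 0 t ⊆ Icc 0 T := Icc_subset_Icc_right ht.2
  have hlim : Tendsto (fun S : Finset ℕ+ => ∫ τ in (0 : ℝ)..t, ∑ k ∈ S, Z k τ) atTop
      (𝓝 (∫ τ in (0 : ℝ)..t, Complex.I * ⟪F τ, y τ⟫_ℂ)) := by
    refine intervalIntegral.tendsto_integral_filter_of_dominated_convergence
      -- Cauchy–Schwarz on coefficients bounds every partial sum by this function, uniformly in the
      -- finite set of modes.
      (fun τ => ‖F τ‖ * ‖y τ‖ + ‖u τ‖ * (‖g τ‖ * ‖M (y τ)‖ + ‖M (g τ)‖ * ‖y τ‖)) ?_ ?_ ?_ ?_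
    · refine Eventually.of_forall fun S => ?_
      refine Finset.aestronglyMeasurable_fun_sum S fun k _ => ?_
      exact (intervalIntegrable_mono_right (hZ k).1 ht).aestronglyMeasurable_restrict_uIoc
    · refine Eventually.of_forall fun S => Eventually.of_forall fun τ _ => ?_
      refine (norm_sum_le _ _).trans ?_
      have hb : ∀ k ∈ S, ‖Z k τ‖ ≤ ‖coeff (F τ) k‖ * ‖coeff (y τ) k‖ +
          ‖u τ‖ * (‖coeff (g τ) k‖ * ‖coeff (M (y τ)) k‖ +
            ‖coeff (M (g τ)) k‖ * ‖coeff (y τ) k‖) := by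
        intro k _
        simp only [Z]
        rw [norm_mul, Complex.norm_I, one_mul]
        refine (norm_add_le _ _).trans ?_
        rw [norm_mul, norm_mul, RCLike.norm_conj, Complex.norm_real]
        gcongr
        refine (norm_sub_le _ _).trans ?_
        rw [norm_mul, norm_mul, RCLike.norm_conj, RCLike.norm_conj]
      refine (Finset.sum_le_sum hb).trans ?_
      rw [Finset.sum_add_distrib, ← Finset.mul_sum, Finset.sum_add_distrib]
      gcongr <;> exact sum_norm_coeff_mul_le _ _ _
    · have hgt := hg.mono hsub
      have hFt := hF.mono hsub
      have hyt := hyc.mono hsub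
      have h1 : ContinuousOn (fun τ => ‖F τ‖ * ‖y τ‖) (uIcc 0 t) := by
        rw [uIcc_of_le ht.1]; exact hFt.norm.mul hyt.norm
      have h2 : ContinuousOn (fun τ => ‖g τ‖ * ‖M (y τ)‖ + ‖M (g τ)‖ * ‖y τ‖) (uIcc 0 t) := by
        rw [uIcc_of_le ht.1]
        exact (hgt.norm.mul (M.continuous.comp_continuousOn hyt).norm).add
          ((M.continuous.comp_continuousOn hgt).norm.mul hyt.norm)
      exact h1.intervalIntegrable.add
        ((intervalIntegrable_mono_right hu ht).norm.mul_continuousOn h2)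
    · refine Eventually.of_forall fun τ _ => ?_
      have h1 := hasSum_conj_coeff_mul_coeff (F τ) (y τ)
      have h2 := hasSum_conj_coeff_mul_coeff (g τ) (M (y τ))
      have h3 := hasSum_conj_coeff_mul_coeff (M (g τ)) (y τ)
      have h4 := (h1.add ((h2.sub h3).mul_left (u τ : ℂ))).mul_left Complex.I
      -- The control terms cancel only after summing over all modes, by symmetry of `M`.
      rw [hM, sub_self, mul_zero, add_zero] at h4
      exact h4
  have hlim2 : Tendsto (fun S : Finset ℕ+ => ∫ τ in (0 : ℝ)..t, ∑ k ∈ S, Z k τ) atTop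
      (𝓝 (⟪g t, y t⟫_ℂ - ⟪g 0, y 0⟫_ℂ)) := by
    have h1 := (hasSum_conj_coeff_mul_coeff (g t) (y t)).sub
      (hasSum_conj_coeff_mul_coeff (g 0) (y 0))
    refine h1.congr fun S => ?_
    rw [intervalIntegral.integral_finsetSum fun k _ => intervalIntegrable_mono_right (hZ k).1 ht]
    refine Finset.sum_congr rfl fun k _ => ?_
    exact sub_eq_of_eq_add' ((hZ k).2 t ht)
  have := tendsto_nhds_unique hlim hlim2
  rw [intervalIntegral.integral_const_mul] at this
  rw [this]; ring

/-- A solution is dual to itself with zero source. -/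
theorem SolvesModes.norm_eq_one (hy : SolvesModes M u T j y)
    (hM : ∀ f g, ⟪M f, g⟫_ℂ = ⟪f, M g⟫_ℂ) (hu : IntervalIntegrable u volume 0 T) (hT : 0 ≤ T)
    {t : ℝ} (ht : t ∈ Icc 0 T) : ‖y t‖ = 1 := by
  have h := hy.inner_eq hM hu hT (F := fun _ => 0) hy.continuousOn continuousOn_const hy.modes
    (fun k t _ => by rw [sub_self, ← coeffCLM_apply, map_zero]) ht
  simp only [inner_zero_left, intervalIntegral.integral_zero, mul_zero, add_zero] at h
  rw [inner_self_eq_ofReal, inner_self_eq_ofReal, hy.initial, orthonormal_eigenvec.1 j] at h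
  have h2 : ‖y t‖ ^ 2 = 1 ^ 2 := Complex.ofReal_injective h
  exact (sq_eq_sq₀ (norm_nonneg _) zero_le_one).1 h2

/-! ### The gauge transform -/

theorem coeff_ofContinuous {f : ℝ → ℂ} (hf : Continuous f) (k : ℕ+) :
    coeff (ofContinuous f hf) k = ∫ x in (0 : ℝ)..1, (eigenfun k x : ℂ) * f x := by
  rw [coeff, eigenvec_eq, inner_ofContinuous]
  simp only [Complex.conj_ofReal]

/-- The phase `e^{iσW}`. -/
def phase (W : ℝ → ℝ) (σ x : ℝ) : ℂ := Complex.exp (((σ * W x : ℝ) : ℂ) * Complex.I)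

theorem norm_phase (W : ℝ → ℝ) (σ x : ℝ) : ‖phase W σ x‖ = 1 := Complex.norm_exp_ofReal_mul_I _

theorem conj_phase_mul_phase (W : ℝ → ℝ) (σ x : ℝ) :
    (starRingEnd ℂ) (phase W σ x) * phase W σ x = 1 := by
  rw [Complex.conj_mul', norm_phase]; simp

theorem continuous_phase_uncurry {W : ℝ → ℝ} (hW : Continuous W) :
    Continuous fun p : ℝ × ℝ => phase W p.1 p.2 := by
  unfold phase; fun_prop

theorem continuous_phase {W : ℝ → ℝ} (hW : Continuous W) (σ : ℝ) : Continuous (phase W σ) := by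
  unfold phase; fun_prop

theorem hasDerivAt_phase_left (W : ℝ → ℝ) (σ x : ℝ) :
    HasDerivAt (fun σ => phase W σ x) (Complex.I * W x * phase W σ x) σ := by
  have h : HasDerivAt (fun σ : ℝ => ((σ * W x : ℝ) : ℂ) * Complex.I) ((W x : ℂ) * Complex.I) σ := by
    have := ((hasDerivAt_id σ).mul_const (W x)).ofReal_comp.mul_const Complex.I
    simpa using this
  refine h.cexp.congr_deriv ?_
  rw [phase]; ring

theorem hasDerivAt_phase_right {W V : ℝ → ℝ} (hWV : ∀ x, HasDerivAt W (V x) x) (σ x : ℝ) :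
    HasDerivAt (phase W σ) (Complex.I * σ * V x * phase W σ x) x := by
  refine (((hWV x).const_mul σ).ofReal_comp.mul_const Complex.I).cexp.congr_deriv ?_
  rw [phase]; push_cast; ring

theorem continuous_gauge {W : ℝ → ℝ} (hW : Continuous W) (j : ℕ+) (σ : ℝ) :
    Continuous fun x => phase W σ x * (eigenfun j x : ℂ) :=
  (continuous_phase hW σ).mul (continuous_eigenfun_ofReal j)

/-- The state `e^{iσW} φ_j`. -/
def gauge {W : ℝ → ℝ} (hW : Continuous W) (j : ℕ+) (σ : ℝ) : L2 :=
  ofContinuous (fun x => phase W σ x * (eigenfun j x : ℂ)) (continuous_gauge hW j σ)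

/-- The function `e^{-iσW} (∂²ₓₓ + λ_j) (e^{iσW} φ_j)`, where `V`, `U` are the first two derivatives
of `W`. -/
def gaugeDefect (V U : ℝ → ℝ) (j : ℕ+) (σ x : ℝ) : ℂ :=
  Complex.I * (σ * (2 * V x * eigenfunDeriv j x + U x * eigenfun j x) : ℝ) -
    (σ ^ 2 * (V x ^ 2 * eigenfun j x) : ℝ)

theorem continuous_gaugeDefect_uncurry {V U : ℝ → ℝ} (hV : Continuous V) (hU : Continuous U)
    (j : ℕ+) : Continuous fun p : ℝ × ℝ => gaugeDefect V U j p.1 p.2 := by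
  have h1 := continuous_eigenfun j
  have h2 := continuous_eigenfunDeriv j
  unfold gaugeDefect
  fun_prop

theorem continuous_gaugeSource {W V U : ℝ → ℝ} (hW : Continuous W) (hV : Continuous V)
    (hU : Continuous U) (j : ℕ+) (σ : ℝ) :
    Continuous fun x => phase W σ x * gaugeDefect V U j σ x :=
  (continuous_phase hW σ).mul
    ((continuous_gaugeDefect_uncurry hV hU j).comp (Continuous.prodMk_right σ))

/-- The state `(∂²ₓₓ + λ_j) (e^{iσW} φ_j)`. -/
def gaugeSource {W V U : ℝ → ℝ} (hW : Continuous W) (hV : Continuous V) (hU : Continuous U)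
    (j : ℕ+) (σ : ℝ) : L2 :=
  ofContinuous (fun x => phase W σ x * gaugeDefect V U j σ x) (continuous_gaugeSource hW hV hU j σ)

section Gauge

variable {W V U : ℝ → ℝ} (hW : Continuous W) (hV : Continuous V) (hU : Continuous U) (j : ℕ+)

theorem continuous_gauge_state : Continuous (gauge hW j) :=
  continuous_ofContinuous (H := fun σ x => phase W σ x * (eigenfun j x : ℂ))
    ((continuous_phase_uncurry hW).mul ((continuous_eigenfun_ofReal j).comp continuous_snd)) _

theorem continuous_gaugeSource_state : Continuous (gaugeSource hW hV hU j) :=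
  continuous_ofContinuous (H := fun σ x => phase W σ x * gaugeDefect V U j σ x)
    ((continuous_phase_uncurry hW).mul (continuous_gaugeDefect_uncurry hV hU j)) _

theorem gauge_zero : gauge hW j 0 = eigenvec j := by
  rw [gauge, eigenvec_eq]
  congr 1
  ext x
  simp [phase]

theorem norm_gauge (σ : ℝ) : ‖gauge hW j σ‖ = 1 := by
  refine (sq_eq_sq₀ (norm_nonneg _) zero_le_one).1 ?_
  rw [gauge, norm_sq_ofContinuous, one_pow]
  refine (intervalIntegral.integral_congr fun x _ => ?_).trans (integral_eigenfun_sq j)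
  simp only [norm_mul, norm_phase, one_mul, Complex.norm_real, Real.norm_eq_abs, sq_abs]
  ring

/-- This is Green's formula for `e^{iσW} φ_j`, which vanishes at the end points because `φ_j` does;
no boundary condition on `W` enters. -/
theorem coeff_gaugeSource (hWV : ∀ x, HasDerivAt W (V x) x) (hVU : ∀ x, HasDerivAt V (U x) x)
    (σ : ℝ) (k : ℕ+) :
    ((eigenvalue j : ℂ) - eigenvalue k) * coeff (gauge hW j σ) k =
      coeff (gaugeSource hW hV hU j σ) k := by
  have h1 : ∀ x, HasDerivAt (fun x => phase W σ x * (eigenfun j x : ℂ))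
      (phase W σ x * (Complex.I * σ * V x * eigenfun j x + eigenfunDeriv j x)) x := by
    intro x
    refine ((hasDerivAt_phase_right hWV σ x).mul (hasDerivAt_eigenfun j x).ofReal_comp).congr_deriv ?_
    ring
  have h2 : ∀ x, HasDerivAt
      (fun x => phase W σ x * (Complex.I * σ * V x * eigenfun j x + eigenfunDeriv j x))
      (phase W σ x * gaugeDefect V U j σ x - eigenvalue j * (phase W σ x * eigenfun j x)) x := by
    intro x
    have h3 : HasDerivAt (fun x => Complex.I * σ * V x * eigenfun j x + eigenfunDeriv j x)
        (Complex.I * σ * U x * eigenfun j x + Complex.I * σ * V x * eigenfunDeriv j x +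
          ((-eigenvalue j * eigenfun j x : ℝ) : ℂ)) x :=
      (((hVU x).ofReal_comp.const_mul (Complex.I * σ)).mul
        (hasDerivAt_eigenfun j x).ofReal_comp).add (hasDerivAt_eigenfunDeriv j x).ofReal_comp
    refine ((hasDerivAt_phase_right hWV σ x).mul h3).congr_deriv ?_
    rw [gaugeDefect]
    push_cast
    linear_combination phase W σ x * σ ^ 2 * V x ^ 2 * eigenfun j x * Complex.I_sq
  have hc1 := continuous_gaugeSource hW hV hU j σ
  have hc2 := continuous_gauge hW j σ
  have hk := continuous_eigenfun_ofReal k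
  have hgreen := integral_eigenfun_mul_deriv_two k h1 h2 (hc1.sub (continuous_const.mul hc2))
    (by simp [eigenfun_zero]) (by simp [eigenfun_one])
  rw [gauge, gaugeSource, coeff_ofContinuous, coeff_ofContinuous]
  have e : ∀ x, (eigenfun k x : ℂ) * (phase W σ x * gaugeDefect V U j σ x -
      eigenvalue j * (phase W σ x * eigenfun j x)) =
      eigenfun k x * (phase W σ x * gaugeDefect V U j σ x) -
        eigenvalue j * (eigenfun k x * (phase W σ x * eigenfun j x)) := fun x => by ring
  simp only [e] at hgreen
  have hc1' : Continuous fun x => (eigenfun k x : ℂ) * (phase W σ x * gaugeDefect V U j σ x) :=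
    hk.mul hc1
  have hc2' : Continuous fun x => (eigenvalue j : ℂ) *
      (eigenfun k x * (phase W σ x * eigenfun j x)) := continuous_const.mul (hk.mul hc2)
  rw [intervalIntegral.integral_sub (hc1'.intervalIntegrable _ _) (hc2'.intervalIntegrable _ _),
    intervalIntegral.integral_const_mul] at hgreen
  linear_combination -hgreen

/-- The phases cancel, and the part of order `σ` integrates the exact derivative of `V φ_j²`, which
vanishes at both ends. Only the quadratic part survives. -/
theorem inner_gaugeSource_gauge (hVU : ∀ x, HasDerivAt V (U x) x) (σ : ℝ) :
    ⟪gaugeSource hW hV hU j σ, gauge hW j σ⟫_ℂ =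
      -((σ ^ 2 * ∫ x in (0 : ℝ)..1, V x ^ 2 * eigenfun j x * eigenfun j x : ℝ) : ℂ) := by
  have h1 := continuous_eigenfun j
  have h2 := continuous_eigenfunDeriv j
  rw [gaugeSource, gauge, inner_ofContinuous]
  have e : ∀ x, (starRingEnd ℂ) (phase W σ x * gaugeDefect V U j σ x) *
      (phase W σ x * eigenfun j x) = -Complex.I * (σ *
        ((2 * V x * eigenfunDeriv j x + U x * eigenfun j x) * eigenfun j x) : ℝ) -
        (σ ^ 2 * (V x ^ 2 * eigenfun j x * eigenfun j x) : ℝ) := by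
    intro x
    rw [gaugeDefect]
    simp only [map_mul, map_sub, Complex.conj_I, Complex.conj_ofReal]
    push_cast
    linear_combination (-Complex.I * (σ *
        ((2 * V x * eigenfunDeriv j x + U x * eigenfun j x) * eigenfun j x)) -
        (σ ^ 2 * (V x ^ 2 * eigenfun j x * eigenfun j x))) * conj_phase_mul_phase W σ x
  have hb : ∫ x in (0 : ℝ)..1,
      (2 * V x * eigenfunDeriv j x + U x * eigenfun j x) * eigenfun j x = 0 := by
    have hd : ∀ x, HasDerivAt (fun x => V x * (eigenfun j x * eigenfun j x))
        ((2 * V x * eigenfunDeriv j x + U x * eigenfun j x) * eigenfun j x) x := fun x => by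
      refine ((hVU x).mul ((hasDerivAt_eigenfun j x).mul (hasDerivAt_eigenfun j x))).congr_deriv ?_
      simp only [Pi.mul_apply]
      ring
    rw [intervalIntegral.integral_eq_sub_of_hasDerivAt (fun x _ => hd x)
      (Continuous.intervalIntegrable (by fun_prop) _ _), eigenfun_zero, eigenfun_one]
    simp
  simp only [e]
  rw [intervalIntegral.integral_sub (Continuous.intervalIntegrable (by fun_prop) _ _)
    (Continuous.intervalIntegrable (by fun_prop) _ _), intervalIntegral.integral_const_mul,
    intervalIntegral.integral_ofReal, intervalIntegral.integral_ofReal,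
    intervalIntegral.integral_const_mul, intervalIntegral.integral_const_mul, hb]
  simp

/-- The phase is unimodular, and the remaining polynomial in `σ` has no constant term because `φ_j`
is an eigenfunction. -/
theorem exists_norm_gaugeSource_le : ∃ C : ℝ, 0 ≤ C ∧
    ∀ σ, ‖gaugeSource hW hV hU j σ‖ ≤ C * (|σ| + σ ^ 2) := by
  have h1 := continuous_eigenfun j
  have h2 := continuous_eigenfunDeriv j
  obtain ⟨C₁, hC₁⟩ := isCompact_Icc.exists_bound_of_continuousOn (Continuous.continuousOn
    (f := fun x => 2 * V x * eigenfunDeriv j x + U x * eigenfun j x) (s := Icc (0 : ℝ) 1)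
    (by fun_prop))
  obtain ⟨C₂, hC₂⟩ := isCompact_Icc.exists_bound_of_continuousOn (Continuous.continuousOn
    (f := fun x => V x ^ 2 * eigenfun j x) (s := Icc (0 : ℝ) 1) (by fun_prop))
  have hC₁0 : 0 ≤ C₁ := (norm_nonneg _).trans (hC₁ 0 ⟨le_rfl, zero_le_one⟩)
  have hC₂0 : 0 ≤ C₂ := (norm_nonneg _).trans (hC₂ 0 ⟨le_rfl, zero_le_one⟩)
  refine ⟨C₁ + C₂, by positivity, fun σ => ?_⟩
  refine norm_ofContinuous_le _ (by positivity) fun x hx => ?_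
  rw [norm_mul, norm_phase, one_mul, gaugeDefect]
  refine (norm_sub_le _ _).trans ?_
  rw [norm_mul, Complex.norm_I, one_mul, Complex.norm_real, Complex.norm_real, norm_mul, norm_mul,
    norm_pow, Real.norm_eq_abs σ, sq_abs]
  have e1 := mul_le_mul_of_nonneg_left (hC₁ x hx) (abs_nonneg σ)
  have e2 := mul_le_mul_of_nonneg_left (hC₂ x hx) (sq_nonneg σ)
  nlinarith [mul_nonneg hC₁0 (sq_nonneg σ), mul_nonneg hC₂0 (abs_nonneg σ)]

theorem hasDerivAt_coeff_gauge {M : L2 →L[ℂ] L2} (hM : ∀ (f : ℝ → ℂ) (hf : Continuous f),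
      M (ofContinuous f hf) = ofContinuous (fun x => (W x : ℂ) * f x)
        ((Complex.continuous_ofReal.comp hW).mul hf)) (k : ℕ+) (σ : ℝ) :
    HasDerivAt (fun σ => coeff (gauge hW j σ) k) (Complex.I * coeff (M (gauge hW j σ)) k) σ := by
  have hk := continuous_eigenfun_ofReal k
  have hj := continuous_eigenfun_ofReal j
  have hWc : Continuous fun x => (W x : ℂ) := Complex.continuous_ofReal.comp hW
  have hF : ∀ σ, Continuous fun x => (eigenfun k x : ℂ) * (phase W σ x * eigenfun j x) :=
    fun σ => hk.mul (continuous_gauge hW j σ)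
  have hF' : Continuous fun x =>
      (eigenfun k x : ℂ) * ((Complex.I * W x * phase W σ x) * eigenfun j x) :=
    hk.mul (((continuous_const.mul hWc).mul (continuous_phase hW σ)).mul hj)
  have key := intervalIntegral.hasDerivAt_integral_of_dominated_loc_of_deriv_le (μ := volume)
    (a := 0) (b := 1) (x₀ := σ) (s := univ)
    (F := fun σ x => (eigenfun k x : ℂ) * (phase W σ x * eigenfun j x))
    (F' := fun σ x => (eigenfun k x : ℂ) * ((Complex.I * W x * phase W σ x) * eigenfun j x))
    (bound := fun x => ‖(eigenfun k x : ℂ)‖ * (‖(W x : ℂ)‖ * ‖(eigenfun j x : ℂ)‖)) univ_mem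
    (Eventually.of_forall fun σ => (hF σ).aestronglyMeasurable)
    ((hF σ).intervalIntegrable _ _) hF'.aestronglyMeasurable
    (Eventually.of_forall fun x _ σ _ => by
      simp only [norm_mul, norm_phase, Complex.norm_I, one_mul, mul_one]; exact le_rfl)
    ((hk.norm.mul (hWc.norm.mul hj.norm)).intervalIntegrable _ _)
    (Eventually.of_forall fun x _ σ _ =>
      ((hasDerivAt_phase_left W σ x).mul_const _).const_mul _)
  have e1 : (fun σ => coeff (gauge hW j σ) k) =
      fun σ => ∫ x in (0 : ℝ)..1, (eigenfun k x : ℂ) * (phase W σ x * eigenfun j x) :=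
    funext fun σ => coeff_ofContinuous _ _
  rw [e1]
  refine key.2.congr_deriv ?_
  rw [gauge, hM, coeff_ofContinuous, ← intervalIntegral.integral_const_mul]
  refine intervalIntegral.integral_congr fun x _ => ?_
  ring

/-- Gauged states have norm one, so each coefficient is `‖M‖`-Lipschitz in `σ` and the chain rule
applies to the merely absolutely continuous `s`. The summand `0` is the choice `q = 0` in
`SolvesModes.inner_eq`. -/
theorem isPrimitive_coeff_gauge {M : L2 →L[ℂ] L2} (hM : ∀ (f : ℝ → ℂ) (hf : Continuous f),
      M (ofContinuous f hf) = ofContinuous (fun x => (W x : ℂ) * f x)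
        ((Complex.continuous_ofReal.comp hW).mul hf)) (k : ℕ+) {u s : ℝ → ℝ} {T : ℝ} (hT : 0 ≤ T)
    (hu : IntervalIntegrable u volume 0 T) (hs : ∀ t, s t = ∫ τ in (0 : ℝ)..t, u τ) :
    IsPrimitive T (fun t => coeff (gauge hW j (s t)) k)
      fun t => Complex.I * (0 + u t * coeff (M (gauge hW j (s t))) k) := by
  have hd := hasDerivAt_coeff_gauge hW j hM k
  have hL : LipschitzWith ‖M‖₊ (fun σ => coeff (gauge hW j σ) k) := by
    refine lipschitzWith_of_nnnorm_deriv_le (fun σ => (hd σ).differentiableAt) fun σ => ?_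
    rw [(hd σ).deriv, ← NNReal.coe_le_coe, coe_nnnorm, coe_nnnorm, norm_mul, Complex.norm_I, one_mul]
    refine (norm_coeff_le _ _).trans ((M.le_opNorm _).trans ?_)
    rw [norm_gauge, mul_one]
  have hc : Continuous fun σ => Complex.I * coeff (M (gauge hW j σ)) k :=
    continuous_const.mul ((coeffCLM k).continuous.comp
      (M.continuous.comp (continuous_gauge_state hW j)))
  refine (IsPrimitive.comp_real hT hu hs hd hL hc).congr hT (fun _ _ => rfl) fun t _ => ?_
  ring

end Gauge

/-! ### The quadratic expansion -/

theorem sq_integral_abs_le {s : ℝ → ℝ} {T : ℝ} (hT : 0 < T) (hs : ContinuousOn s (Icc 0 T)) :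
    (∫ t in (0 : ℝ)..T, |s t|) ^ 2 ≤ T * ∫ t in (0 : ℝ)..T, s t ^ 2 := by
  have hu : uIcc 0 T = Icc 0 T := uIcc_of_le hT.le
  have h1 : IntervalIntegrable (fun t => |s t|) volume 0 T :=
    ContinuousOn.intervalIntegrable (by rw [hu]; exact hs.abs)
  have h2 : IntervalIntegrable (fun t => s t ^ 2) volume 0 T :=
    ContinuousOn.intervalIntegrable (by rw [hu]; exact hs.pow 2)
  set A := ∫ t in (0 : ℝ)..T, |s t| with hA
  -- Cauchy–Schwarz against the constant function, as nonnegativity of the variance of `|s|`.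
  have h3 : 0 ≤ ∫ t in (0 : ℝ)..T, (T * |s t| - A) ^ 2 :=
    intervalIntegral.integral_nonneg hT.le fun t _ => sq_nonneg _
  have h4 : ∀ t, (T * |s t| - A) ^ 2 = T ^ 2 * s t ^ 2 - 2 * T * A * |s t| + A ^ 2 := fun t => by
    rw [← sq_abs (s t)]; ring
  simp only [h4] at h3
  rw [intervalIntegral.integral_add ((h2.const_mul _).sub (h1.const_mul _)) (by simp),
    intervalIntegral.integral_sub (h2.const_mul _) (h1.const_mul _),
    intervalIntegral.integral_const_mul, intervalIntegral.integral_const_mul,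
    intervalIntegral.integral_const, smul_eq_mul, ← hA] at h3
  have h5 : 0 ≤ T * (T * (∫ t in (0 : ℝ)..T, s t ^ 2) - A ^ 2) := by linarith
  linarith [nonneg_of_mul_nonneg_right h5 hT]

/-- The second order expansion of a solution along the gauge transformed eigenstate. -/
theorem exists_quadratic_expansion {W V U : ℝ → ℝ} (hW : Continuous W) (hV : Continuous V)
    (hU : Continuous U) (hWV : ∀ x, HasDerivAt W (V x) x) (hVU : ∀ x, HasDerivAt V (U x) x)
    {M : L2 →L[ℂ] L2} (hMs : ∀ f g, ⟪M f, g⟫_ℂ = ⟪f, M g⟫_ℂ)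
    (hM : ∀ (f : ℝ → ℂ) (hf : Continuous f), M (ofContinuous f hf) =
      ofContinuous (fun x => (W x : ℂ) * f x) ((Complex.continuous_ofReal.comp hW).mul hf))
    (j : ℕ+) : ∃ K : ℝ, 0 ≤ K ∧ ∀ (T : ℝ) (u s : ℝ → ℝ) (y : ℝ → L2), 0 < T →
      IntervalIntegrable u volume 0 T → (∀ t, s t = ∫ τ in (0 : ℝ)..t, u τ) →
      (∀ t ∈ Icc 0 T, |s t| ≤ 1) → SolvesModes M u T j y →
      ‖⟪gauge hW j (s T), y T⟫_ℂ - 1 + Complex.I *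
        (((∫ x in (0 : ℝ)..1, V x ^ 2 * eigenfun j x * eigenfun j x) *
          ∫ t in (0 : ℝ)..T, s t ^ 2 : ℝ) : ℂ)‖ ≤ K * T * ∫ t in (0 : ℝ)..T, s t ^ 2 := by
  obtain ⟨C, hC0, hC⟩ := exists_norm_gaugeSource_le hW hV hU j
  refine ⟨8 * C ^ 2, by positivity, fun T u s y hT hu hs hs1 hy => ?_⟩
  have huI : uIcc 0 T = Icc 0 T := uIcc_of_le hT.le
  set m := ∫ x in (0 : ℝ)..1, V x ^ 2 * eigenfun j x * eigenfun j x with hm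
  have hsc : ContinuousOn s (Icc 0 T) := by
    rw [funext hs, ← huI]
    exact (hu.absolutelyContinuousOnInterval_intervalIntegral left_mem_uIcc).continuousOn
  have hgc : ContinuousOn (fun t => gauge hW j (s t)) (Icc 0 T) :=
    (continuous_gauge_state hW j).comp_continuousOn hsc
  have hFc : ContinuousOn (fun t => gaugeSource hW hV hU j (s t)) (Icc 0 T) :=
    (continuous_gaugeSource_state hW hV hU j).comp_continuousOn hsc
  have hs0 : s 0 = 0 := by simp [hs]
  have hsub : ∀ {t}, t ∈ Icc (0 : ℝ) T → Icc 0 t ⊆ Icc 0 T := fun ht => Icc_subset_Icc_right ht.2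
  set r : ℝ → L2 := fun t => y t - gauge hW j (s t) with hr
  have hrc : ContinuousOn r (Icc 0 T) := hy.continuousOn.sub hgc
  have hz : ∀ t ∈ Icc 0 T, ⟪gauge hW j (s t), y t⟫_ℂ = 1 +
      Complex.I * (∫ τ in (0 : ℝ)..t, ⟪gaugeSource hW hV hU j (s τ), r τ⟫_ℂ) -
      Complex.I * ((m * ∫ τ in (0 : ℝ)..t, s τ ^ 2 : ℝ) : ℂ) := by
    intro t ht
    have huIt : uIcc 0 t = Icc 0 t := uIcc_of_le ht.1
    have h := hy.inner_eq hMs hu hT.le (q := fun _ _ => 0) hgc hFc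
      (fun k => isPrimitive_coeff_gauge hW j hM k hT.le hu hs)
      (fun k t _ => by rw [sub_zero]; exact coeff_gaugeSource hW hV hU j hWV hVU (s t) k) ht
    rw [hs0, gauge_zero, hy.initial, inner_self_eq_ofReal, orthonormal_eigenvec.1 j] at h
    -- Splitting `y = g + r` isolates the explicit quadratic term; the part in `r` will be of second
    -- order as well.
    have e : ∀ τ, ⟪gaugeSource hW hV hU j (s τ), y τ⟫_ℂ =
        ⟪gaugeSource hW hV hU j (s τ), r τ⟫_ℂ - ((m * s τ ^ 2 : ℝ) : ℂ) := fun τ => by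
      have := inner_gaugeSource_gauge hW hV hU j hVU (s τ)
      rw [hr, inner_sub_right, this, ← hm, mul_comm m]; ring
    simp only [e] at h
    rw [intervalIntegral.integral_sub, intervalIntegral.integral_ofReal,
      intervalIntegral.integral_const_mul] at h
    · rw [h]; push_cast; ring
    · refine ContinuousOn.intervalIntegrable ?_
      rw [huIt]
      exact (hFc.mono (hsub ht)).inner (𝕜 := ℂ) (hrc.mono (hsub ht))
    · refine ContinuousOn.intervalIntegrable ?_
      rw [huIt]
      exact Complex.continuous_ofReal.comp_continuousOn
        (continuousOn_const.mul ((hsc.mono (hsub ht)).pow 2))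
  set J := ∫ τ in (0 : ℝ)..T, ‖gaugeSource hW hV hU j (s τ)‖ with hJ
  have hJi : IntervalIntegrable (fun τ => ‖gaugeSource hW hV hU j (s τ)‖) volume 0 T :=
    ContinuousOn.intervalIntegrable (by rw [huI]; exact hFc.norm)
  have hJ0 : 0 ≤ J := intervalIntegral.integral_nonneg hT.le fun _ _ => norm_nonneg _
  obtain ⟨t₀, ht₀, hmax⟩ := isCompact_Icc.exists_isMaxOn ⟨0, left_mem_Icc.2 hT.le⟩ hrc.norm
  have hint : ∀ t ∈ Icc 0 T,
      ‖∫ τ in (0 : ℝ)..t, ⟪gaugeSource hW hV hU j (s τ), r τ⟫_ℂ‖ ≤ ‖r t₀‖ * J := by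
    intro t ht
    have h1 : IntervalIntegrable (fun τ => ‖r t₀‖ * ‖gaugeSource hW hV hU j (s τ)‖) volume 0 T :=
      hJi.const_mul _
    calc _ ≤ ∫ τ in (0 : ℝ)..t, ‖r t₀‖ * ‖gaugeSource hW hV hU j (s τ)‖ := by
          refine intervalIntegral.norm_integral_le_of_norm_le ht.1
            (Eventually.of_forall fun τ hτ => ?_) (intervalIntegrable_mono_right h1 ht)
          refine (norm_inner_le_norm _ _).trans ?_
          rw [mul_comm]
          gcongr
          exact hmax ⟨hτ.1.le, hτ.2.trans ht.2⟩
      _ ≤ ∫ τ in (0 : ℝ)..T, ‖r t₀‖ * ‖gaugeSource hW hV hU j (s τ)‖ :=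
          intervalIntegral.integral_mono_interval le_rfl ht.1 ht.2
            (Eventually.of_forall fun τ => by positivity) h1
      _ = ‖r t₀‖ * J := intervalIntegral.integral_const_mul _ _
  -- Both states have norm one, so `‖r‖²` is twice `1 - Re ⟪g, y⟫`. The quadratic term is purely
  -- imaginary and drops out, leaving `‖r‖² ≤ 2 J ‖r‖` at the maximum point.
  have hr2 : ‖r t₀‖ ≤ 2 * J := by
    have h1 : ‖r t₀‖ ^ 2 = 2 - 2 * (⟪gauge hW j (s t₀), y t₀⟫_ℂ).re := by
      have h2 := norm_sub_sq (𝕜 := ℂ) (y t₀) (gauge hW j (s t₀))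
      rw [hy.norm_eq_one hMs hu hT.le ht₀, norm_gauge, ← inner_conj_symm] at h2
      simp only [RCLike.re_to_complex, Complex.conj_re] at h2
      rw [hr, h2]; ring
    have h3 := hint t₀ ht₀
    rw [hz t₀ ht₀] at h1
    simp only [Complex.add_re, Complex.sub_re, Complex.one_re, Complex.I_mul_re,
      Complex.ofReal_im, neg_zero, sub_zero] at h1
    have h5 : ‖r t₀‖ * ‖r t₀‖ ≤ 2 * J * ‖r t₀‖ := by
      have := (le_abs_self _).trans (Complex.abs_im_le_norm
        (∫ τ in (0 : ℝ)..t₀, ⟪gaugeSource hW hV hU j (s τ), r τ⟫_ℂ))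
      nlinarith
    rcases (norm_nonneg (r t₀)).eq_or_lt with h6 | h6
    · rw [← h6]; positivity
    · exact le_of_mul_le_mul_right h5 h6
  have hTm : T ∈ Icc 0 T := right_mem_Icc.2 hT.le
  rw [hz T hTm]
  have e : (1 : ℂ) + Complex.I * (∫ τ in (0 : ℝ)..T, ⟪gaugeSource hW hV hU j (s τ), r τ⟫_ℂ) -
      Complex.I * ((m * ∫ τ in (0 : ℝ)..T, s τ ^ 2 : ℝ) : ℂ) - 1 +
      Complex.I * ((m * ∫ t in (0 : ℝ)..T, s t ^ 2 : ℝ) : ℂ) =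
      Complex.I * ∫ τ in (0 : ℝ)..T, ⟪gaugeSource hW hV hU j (s τ), r τ⟫_ℂ := by ring
  rw [e, norm_mul, Complex.norm_I, one_mul]
  refine (hint T hTm).trans ?_
  -- Since `|s| ≤ 1`, the bound `C (|s| + s²)` is at most `2 C |s|`.
  have hJ2 : J ≤ 2 * C * ∫ t in (0 : ℝ)..T, |s t| := by
    rw [← intervalIntegral.integral_const_mul]
    refine intervalIntegral.integral_mono_on hT.le hJi
      (ContinuousOn.intervalIntegrable (by rw [huI]; exact continuousOn_const.mul hsc.abs))
      fun t ht => (hC (s t)).trans ?_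
    have h1 := hs1 t ht
    have h2 : s t ^ 2 ≤ |s t| := by
      rw [← sq_abs]; nlinarith [abs_nonneg (s t)]
    nlinarith
  have hcs := sq_integral_abs_le hT hsc
  have hA0 : 0 ≤ ∫ t in (0 : ℝ)..T, |s t| :=
    intervalIntegral.integral_nonneg hT.le fun _ _ => abs_nonneg _
  -- The error is quadratic in `∫|s|`, and Cauchy–Schwarz turns this into the decisive factor `T`.
  calc ‖r t₀‖ * J ≤ 2 * J * J := by gcongr
    _ = 2 * J ^ 2 := by ring
    _ ≤ 2 * (2 * C * ∫ t in (0 : ℝ)..T, |s t|) ^ 2 := by gcongr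
    _ = 8 * C ^ 2 * (∫ t in (0 : ℝ)..T, |s t|) ^ 2 := by ring
    _ ≤ 8 * C ^ 2 * (T * ∫ t in (0 : ℝ)..T, s t ^ 2) := by gcongr
    _ = _ := by ring

theorem norm_exp_ofReal_mul_I_sub_le (θ : ℝ) :
    ‖Complex.exp (θ * Complex.I) - 1 - θ * Complex.I‖ ≤ 3 * θ ^ 2 := by
  have hn : ‖(θ : ℂ) * Complex.I‖ = |θ| := by simp
  rcases le_total |θ| 1 with h | h
  · have := Complex.norm_exp_sub_one_sub_id_le (x := θ * Complex.I) (by rwa [hn])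
    rw [hn, sq_abs] at this
    nlinarith [sq_nonneg θ]
  · calc ‖Complex.exp (θ * Complex.I) - 1 - θ * Complex.I‖
        ≤ ‖Complex.exp (θ * Complex.I)‖ + ‖(1 : ℂ)‖ + ‖(θ : ℂ) * Complex.I‖ :=
          (norm_sub_le _ _).trans (by gcongr; exact norm_sub_le _ _)
      _ = 2 + |θ| := by rw [Complex.norm_exp_ofReal_mul_I, hn, norm_one]; ring
      _ ≤ 3 * |θ| ^ 2 := by nlinarith
      _ = 3 * θ ^ 2 := by rw [sq_abs]

/-- First-order Taylor expansion of the conjugated phase, integrated against the weight `φ_j²` of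
mass one. -/
theorem exists_norm_inner_gauge_sub_le {W : ℝ → ℝ} (hW : Continuous W) (j : ℕ+) :
    ∃ R : ℝ, 0 ≤ R ∧ ∀ σ : ℝ, ‖⟪gauge hW j σ, eigenvec j⟫_ℂ - 1 + Complex.I *
      ((σ * ∫ x in (0 : ℝ)..1, W x * eigenfun j x * eigenfun j x : ℝ) : ℂ)‖ ≤ R * σ ^ 2 := by
  have hj := continuous_eigenfun_ofReal j
  have hj' := continuous_eigenfun j
  have hp := fun σ => continuous_phase hW σ
  obtain ⟨C, hC⟩ := isCompact_Icc.exists_bound_of_continuousOn (Continuous.continuousOn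
    (f := fun x => 3 * (W x) ^ 2 * (eigenfun j x * eigenfun j x)) (s := Icc (0 : ℝ) 1)
    (by fun_prop))
  refine ⟨C, (norm_nonneg _).trans (hC 0 ⟨le_rfl, zero_le_one⟩), fun σ => ?_⟩
  have hpc : Continuous fun x => (starRingEnd ℂ) (phase W σ x * eigenfun j x) * eigenfun j x :=
    (Complex.continuous_conj.comp ((hp σ).mul hj)).mul hj
  have e1 : (1 : ℂ) = ∫ x in (0 : ℝ)..1, ((eigenfun j x * eigenfun j x : ℝ) : ℂ) := by
    rw [intervalIntegral.integral_ofReal, integral_eigenfun_sq, Complex.ofReal_one]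
  have e2 : Complex.I * ((σ * ∫ x in (0 : ℝ)..1, W x * eigenfun j x * eigenfun j x : ℝ) : ℂ) =
      ∫ x in (0 : ℝ)..1, Complex.I * ((σ * (W x * eigenfun j x * eigenfun j x) : ℝ) : ℂ) := by
    rw [intervalIntegral.integral_const_mul, intervalIntegral.integral_ofReal,
      intervalIntegral.integral_const_mul]
  rw [gauge, eigenvec_eq, inner_ofContinuous, e2]
  nth_rw 1 [e1]
  have hq : Continuous fun x => ((eigenfun j x * eigenfun j x : ℝ) : ℂ) := by fun_prop
  rw [← intervalIntegral.integral_sub (hpc.intervalIntegrable _ _) (hq.intervalIntegrable _ _),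
    ← intervalIntegral.integral_add
      ((hpc.intervalIntegrable _ _).sub (hq.intervalIntegrable _ _))
      (Continuous.intervalIntegrable (by fun_prop) _ _)]
  refine (intervalIntegral.norm_integral_le_of_norm_le_const (C := C * σ ^ 2) fun x hx => ?_).trans
    (by simp)
  rw [uIoc_of_le zero_le_one] at hx
  have hx' := (le_abs_self _).trans (hC x ⟨hx.1.le, hx.2⟩)
  have hb := norm_exp_ofReal_mul_I_sub_le (σ * W x)
  rw [← RCLike.norm_conj] at hb
  have e3 : (starRingEnd ℂ) (phase W σ x * eigenfun j x) * eigenfun j x -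
      ((eigenfun j x * eigenfun j x : ℝ) : ℂ) +
      Complex.I * ((σ * (W x * eigenfun j x * eigenfun j x) : ℝ) : ℂ) =
      (starRingEnd ℂ) (Complex.exp (((σ * W x : ℝ) : ℂ) * Complex.I) - 1 -
        ((σ * W x : ℝ) : ℂ) * Complex.I) * ((eigenfun j x * eigenfun j x : ℝ) : ℂ) := by
    rw [phase]
    simp only [map_mul, map_sub, map_one, Complex.conj_I, Complex.conj_ofReal]
    push_cast
    ring
  rw [e3, norm_mul, Complex.norm_real, Real.norm_of_nonneg (mul_self_nonneg (eigenfun j x))]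
  calc _ ≤ 3 * (σ * W x) ^ 2 * (eigenfun j x * eigenfun j x) :=
        mul_le_mul_of_nonneg_right hb (mul_self_nonneg _)
    _ = 3 * W x ^ 2 * (eigenfun j x * eigenfun j x) * σ ^ 2 := by ring
    _ ≤ C * σ ^ 2 := mul_le_mul_of_nonneg_right hx' (sq_nonneg _)

/-! ### The sign obstruction -/

/-- Lets one small constant meet finitely many smallness requirements at once. -/
theorem exists_pos_mul_le (X : List (ℝ × ℝ)) (hX : ∀ p ∈ X, 0 < p.2) :
    ∃ η : ℝ, 0 < η ∧ ∀ p ∈ X, p.1 * η ≤ p.2 := by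
  induction X with
  | nil => exact ⟨1, one_pos, by simp⟩
  | cons p X ih =>
    obtain ⟨η, hη, h⟩ := ih fun q hq => hX q (List.mem_cons_of_mem _ hq)
    have hp := hX p List.mem_cons_self
    have hpos : 0 < p.2 / (|p.1| + 1) := by positivity
    refine ⟨min η (p.2 / (|p.1| + 1)), lt_min hη hpos, fun q hq => ?_⟩
    have hm : 0 < min η (p.2 / (|p.1| + 1)) := lt_min hη hpos
    rcases List.mem_cons.1 hq with rfl | hq
    · have h1 : min η (q.2 / (|q.1| + 1)) * (|q.1| + 1) ≤ q.2 := by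
        rw [← le_div_iff₀ (by positivity)]; exact min_le_right _ _
      nlinarith [le_abs_self q.1]
    · have h1 := h q hq
      rcases le_total q.1 0 with h0 | h0
      · exact (mul_nonpos_of_nonpos_of_nonneg h0 hm.le).trans (hX q (List.mem_cons_of_mem _ hq)).le
      · exact (mul_le_mul_of_nonneg_left (min_le_left _ _) h0).trans h1

/-- The real-variable core: `S` stands for `∫ s²`, `q` for `√(1-δ²)`, and `p`, `r` for the errors in
the real and imaginary parts of `⟪g₂(σ), φ₂⟫`. Eliminating `σ` between the two relations leaves two
terms of equal sign that the errors cannot balance. -/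
theorem exists_sign_obstruction {a₁ a₂ m₁ m₂ R : ℝ} (hR : 0 ≤ R) (ha : a₁ ≠ 0)
    (hA : a₁ * m₂ - a₂ * m₁ ≠ 0) :
    ∃ η : ℝ, 0 < η ∧ η ≤ 1 ∧ ∀ σ S δ q p r : ℝ, |σ| ≤ η → 0 ≤ S → S ≤ η → 0 < δ → 0 ≤ q → q ≤ 1 →
      1 - q ≤ δ → |p| ≤ R * σ ^ 2 → |r| ≤ R * σ ^ 2 →
      |σ * a₁ - m₁ * S| ≤ η * S + R * σ ^ 2 →
      |Real.sign ((a₁ * m₂ - a₂ * m₁) * a₁) * δ * (1 + p) + q * (r - σ * a₂) + m₂ * S| ≤ η * S →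
      False := by
  set A := a₁ * m₂ - a₂ * m₁ with hAdef
  have ha' : 0 < |a₁| := abs_pos.2 ha
  have hA' : 0 < |A| := abs_pos.2 hA
  -- With `Rσ²` absorbed into `|a₁| |σ| / 2`, the first relation yields `|σ| ≤ L S`; hence `Rσ²` is
  -- `O(η S)`.
  set L := 2 * (|m₁| + 1) / |a₁| with hL
  have hL0 : 0 ≤ L := by positivity
  have hLa : L * |a₁| = 2 * (|m₁| + 1) := div_mul_cancel₀ _ ha'.ne'
  obtain ⟨η, hη, hX⟩ := exists_pos_mul_le
    -- In order: `η ≤ 1`; absorption of `Rσ²` in the bound on `σ`; `|p| ≤ 1/2`; the term with `1 -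
    -- q`, charged to `δ`; all errors of size `η S`, charged to `|𝒜| S`.
    [(1, 1), (R, |a₁| / 2), (R, 1 / 2), (|a₂ * m₁|, |a₁| / 4),
      ((|a₁| + |a₂|) * (1 + R * L), |A|)] (by
    simp only [List.mem_cons, List.not_mem_nil, or_false, forall_eq_or_imp, forall_eq]
    refine ⟨one_pos, by positivity, by norm_num, by positivity, hA'⟩)
  simp only [List.mem_cons, List.not_mem_nil, or_false, forall_eq_or_imp, forall_eq] at hX
  obtain ⟨hη1, h1, h2, h3, h4⟩ := hX
  rw [one_mul] at hη1
  refine ⟨η, hη, hη1, fun σ S δ q p r hσ hS0 hS hδ hq0 hq1 hqδ hp hr e1 e2 => ?_⟩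
  have hσ2 : R * σ ^ 2 ≤ R * η * |σ| := by
    rw [← sq_abs]; nlinarith [mul_nonneg hR (abs_nonneg σ)]
  have hσS : |σ| ≤ L * S := by
    have b1 : |σ| * |a₁| ≤ |m₁| * S + (η * S + R * σ ^ 2) := by
      rw [← abs_mul]
      have b2 := abs_add_le (σ * a₁ - m₁ * S) (m₁ * S)
      rw [sub_add_cancel, abs_mul m₁, abs_of_nonneg hS0] at b2
      linarith
    have b3 : R * η * |σ| ≤ |a₁| / 2 * |σ| := by gcongr
    have b4 : η * S ≤ 1 * S := by gcongr
    have b5 : |σ| * |a₁| ≤ L * S * |a₁| := by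
      rw [mul_right_comm, hLa]; linarith
    exact le_of_mul_le_mul_right b5 ha'
  have hRσ : R * σ ^ 2 ≤ η * (R * L) * S := by
    have : R * η * |σ| ≤ R * η * (L * S) := by gcongr
    linarith
  have hp2 : -(1 / 2) ≤ p := by
    have b1 : R * η * |σ| ≤ 1 / 2 * 1 := by
      have := hσ.trans hη1
      gcongr
    linarith [(abs_le.1 (hp.trans (hσ2.trans b1))).1]
  set α := Real.sign (A * a₁) with hα
  set w := α * δ * (1 + p) + q * (r - σ * a₂) + m₂ * S with hw
  -- `ϑ` is the sign of `𝒜`; by the choice of `α` it is also that of `a₁ α`. Here the sign of the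
  -- target enters.
  have hsign : ∃ ϑ : ℝ, |ϑ| = 1 ∧ ϑ * A = |A| ∧ ϑ * (a₁ * α) = |a₁| := by
    rcases lt_or_gt_of_ne hA with hA0 | hA0 <;> rcases lt_or_gt_of_ne ha with ha0 | ha0
    · exact ⟨-1, by simp, by rw [abs_of_neg hA0]; ring, by
        rw [hα, Real.sign_of_pos (mul_pos_of_neg_of_neg hA0 ha0), abs_of_neg ha0]; ring⟩
    · exact ⟨-1, by simp, by rw [abs_of_neg hA0]; ring, by
        rw [hα, Real.sign_of_neg (mul_neg_of_neg_of_pos hA0 ha0), abs_of_pos ha0]; ring⟩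
    · exact ⟨1, by simp, by rw [abs_of_pos hA0]; ring, by
        rw [hα, Real.sign_of_neg (mul_neg_of_pos_of_neg hA0 ha0), abs_of_neg ha0]; ring⟩
    · exact ⟨1, by simp, by rw [abs_of_pos hA0]; ring, by
        rw [hα, Real.sign_of_pos (mul_pos hA0 ha0), abs_of_pos ha0]; ring⟩
  obtain ⟨ϑ, hϑ1, hϑA, hϑa⟩ := hsign
  have hid : |a₁| * δ * (1 + p) + |A| * S = ϑ * (a₁ * w) - ϑ * (a₁ * q * r) +
      ϑ * (q * a₂ * (σ * a₁ - m₁ * S)) + ϑ * ((q - 1) * (a₂ * m₁) * S) := by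
    rw [← hϑA, ← hϑa, hw, hAdef]; ring
  have c1 : ϑ * (a₁ * w) ≤ |a₁| * (η * S) := by
    refine (le_abs_self _).trans ?_
    rw [abs_mul, hϑ1, one_mul, abs_mul]
    gcongr
  have c2 : -(ϑ * (a₁ * q * r)) ≤ |a₁| * (η * (R * L) * S) := by
    refine (neg_le_abs _).trans ?_
    rw [abs_mul, hϑ1, one_mul, abs_mul, abs_mul, abs_of_nonneg hq0]
    calc |a₁| * q * |r| ≤ |a₁| * 1 * (η * (R * L) * S) := by
          gcongr
          exact hr.trans hRσ
      _ = _ := by ring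
  have c3 : ϑ * (q * a₂ * (σ * a₁ - m₁ * S)) ≤ |a₂| * (η * S + η * (R * L) * S) := by
    refine (le_abs_self _).trans ?_
    rw [abs_mul, hϑ1, one_mul, abs_mul, abs_mul, abs_of_nonneg hq0]
    calc q * |a₂| * |σ * a₁ - m₁ * S| ≤ 1 * |a₂| * (η * S + η * (R * L) * S) := by
          gcongr
          linarith
      _ = _ := by ring
  have c4 : ϑ * ((q - 1) * (a₂ * m₁) * S) ≤ δ * (|a₁| / 4) := by
    refine (le_abs_self _).trans ?_
    rw [abs_mul, hϑ1, one_mul, abs_mul, abs_mul, abs_of_nonneg hS0, abs_sub_comm,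
      abs_of_nonneg (sub_nonneg.2 hq1)]
    calc (1 - q) * |a₂ * m₁| * S ≤ δ * |a₂ * m₁| * η := by gcongr
      _ = δ * (|a₂ * m₁| * η) := by ring
      _ ≤ _ := by gcongr
  have c5 : (|a₁| + |a₂|) * (1 + R * L) * η * S ≤ |A| * S := by gcongr
  have c6 : |a₁| * δ * (1 / 2) ≤ |a₁| * δ * (1 + p) := by
    gcongr
    linarith
  have c7 : 0 < |a₁| * δ := by positivity
  -- The left side of `hid` is at least `|a₁| δ / 2 + |𝒜| S`, the right side at most `|a₁| δ / 4 +
  -- |𝒜| S`.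
  nlinarith

/-! ### Elementary bounds on the target and the control. -/

theorem one_sub_sqrt_le {δ : ℝ} (hδ : 0 < δ) : 1 - Real.sqrt (1 - δ ^ 2) ≤ δ := by
  rcases le_total δ 1 with h | h
  · have : 1 - δ ≤ Real.sqrt (1 - δ ^ 2) := Real.le_sqrt_of_sq_le (by nlinarith)
    linarith
  · linarith [Real.sqrt_nonneg (1 - δ ^ 2)]

theorem sqrt_one_sub_sq_lt_one {δ : ℝ} (hδ : 0 < δ) : Real.sqrt (1 - δ ^ 2) < 1 := by
  rw [Real.sqrt_lt' one_pos]
  nlinarith [pow_pos hδ 2]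

theorem integral_norm_le_of_eLpNorm_lt {u : ℝ → ℝ} {T ε : ℝ} (hT : 0 < T) (hT1 : T ≤ 1)
    (hε : 0 < ε) (hu : MemLp u 2 ((volume : Measure ℝ).restrict (Ioo (0 : ℝ) T)))
    (h : eLpNorm u 2 ((volume : Measure ℝ).restrict (Ioo (0 : ℝ) T)) < ENNReal.ofReal ε) :
    IntervalIntegrable u volume 0 T ∧ ∫ t in (0 : ℝ)..T, |u t| ≤ ε := by
  have : IsFiniteMeasure ((volume : Measure ℝ).restrict (Ioo (0 : ℝ) T)) := ⟨by simp⟩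
  have hi : Integrable u ((volume : Measure ℝ).restrict (Ioo (0 : ℝ) T)) :=
    hu.integrable (by norm_num)
  refine ⟨(intervalIntegrable_iff_integrableOn_Ioo_of_le hT.le).2 hi, ?_⟩
  rw [intervalIntegral.integral_of_le hT.le, integral_Ioc_eq_integral_Ioo]
  have h1 := eLpNorm_le_eLpNorm_mul_rpow_measure_univ (p := 1) (q := 2) (by norm_num) hu.1
  -- The Hölder factor between `L¹` and `L²` is `√T`, harmless for `T ≤ 1`.
  have h2 : ((volume : Measure ℝ).restrict (Ioo (0 : ℝ) T)) univ ^
      (1 / (1 : ℝ≥0∞).toReal - 1 / (2 : ℝ≥0∞).toReal) ≤ 1 := by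
    refine ENNReal.rpow_le_one ?_ (by norm_num)
    simpa using hT1
  have h3 : eLpNorm u 1 ((volume : Measure ℝ).restrict (Ioo (0 : ℝ) T)) ≤ ENNReal.ofReal ε :=
    h1.trans ((mul_le_of_le_one_right' h2).trans h.le)
  rw [eLpNorm_one_eq_lintegral_enorm] at h3
  have h4 := integral_norm_eq_lintegral_enorm hi.1
  simp only [Real.norm_eq_abs] at h4
  rw [h4]
  exact ENNReal.toReal_le_of_le_ofReal hε.le h3

theorem diagCoeff_eq {m f : ℝ → ℝ} (h : ∀ᵐ x, x ∈ Ioo (0 : ℝ) 1 → m x = f x) (k : ℕ+) :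
    diagCoeff m k = ∫ x in (0 : ℝ)..1, f x * eigenfun k x * eigenfun k x := by
  rw [diagCoeff, intervalIntegral.integral_of_le zero_le_one, integral_Ioc_eq_integral_Ioo]
  refine setIntegral_congr_ae measurableSet_Ioo ?_
  filter_upwards [h] with x hx hx'
  rw [hx hx']

theorem exp_smul_smul_eigenstate (k : ℕ+) (t : ℝ) (c : ℂ) :
    Complex.exp (Complex.I * (eigenvalue k : ℂ) * (t : ℂ)) • c • eigenstate k t =
      c • eigenvec k := by
  rw [eigenstate, smul_smul, smul_smul]
  congr 1
  have : Complex.exp (Complex.I * (eigenvalue k : ℂ) * (t : ℂ)) *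
      Complex.exp (-Complex.I * (eigenvalue k : ℂ) * (t : ℂ)) = 1 := by
    rw [← Complex.exp_add]; simp
  linear_combination c * this

end SchrodingerControl

end

/-! ### The obstruction theorem. -/

theorem theorem1
    (μ dμ : ℝ → ℝ)
    (hμ : SchrodingerControl.MemSobolev 3 μ)
    (hdμ : SchrodingerControl.IsWeakDeriv μ dμ)
    (hA : SchrodingerControl.quantityA μ dμ ≠ 0)
    (α : ℝ)
    (hα : α = Real.sign
      (SchrodingerControl.quantityA μ dμ * SchrodingerControl.diagCoeff μ 1)) :
    ∃ Tstar : ℝ, 0 < Tstar ∧ ∃ ε : ℝ, 0 < ε ∧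
      ∀ T : ℝ, 0 < T → T < Tstar →
      ∀ u : ℝ → ℝ, MemLp u 2 ((volume : Measure ℝ).restrict (Ioo (0 : ℝ) T)) →
        eLpNorm u 2 ((volume : Measure ℝ).restrict (Ioo (0 : ℝ) T)) < ENNReal.ofReal ε →
      ∀ ψ₁ ψ₂ : ℝ → SchrodingerControl.L2,
        SchrodingerControl.IsWeakSolution μ u T (SchrodingerControl.eigenvec 1) ψ₁ →
        SchrodingerControl.IsWeakSolution μ u T (SchrodingerControl.eigenvec 2) ψ₂ →
      ∀ δ : ℝ, 0 < δ →
        (ψ₁ T, ψ₂ T) ≠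
          (SchrodingerControl.eigenstate 1 T,
            ((Real.sqrt (1 - δ ^ 2) : ℂ) + Complex.I * (α : ℂ) * (δ : ℂ)) •
              SchrodingerControl.eigenstate 2 T) := by
  open SchrodingerControl in
  obtain ⟨W, V, U, hU, hWV, hVU, hμW, hdμV⟩ := hμ.exists_smooth_representative hdμ
  have hW : Continuous W := continuous_iff_continuousAt.2 fun x => (hWV x).continuousAt
  have hV : Continuous V := continuous_iff_continuousAt.2 fun x => (hVU x).continuousAt
  obtain ⟨M, hMμ, hMs, hM⟩ := exists_mulPot_clm hW hμW
  have hm : ∀ k, diagCoeff (fun x => dμ x ^ 2) k =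
      ∫ x in (0 : ℝ)..1, V x ^ 2 * eigenfun k x * eigenfun k x := fun k => by
    refine diagCoeff_eq ?_ k
    filter_upwards [hdμV] with x hx hx'
    rw [hx hx']
  have ha : ∀ k, diagCoeff μ k = ∫ x in (0 : ℝ)..1, W x * eigenfun k x * eigenfun k x :=
    diagCoeff_eq hμW
  -- Here `α = 0`, so the second target has norm `√(1-δ²) < 1`, while the flow preserves the norm.
  by_cases ha1 : diagCoeff μ 1 = 0
  · refine ⟨1, one_pos, 1, one_pos, fun T hT hT1 u hu hu1 ψ₁ ψ₂ h₁ h₂ δ hδ heq => ?_⟩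
    have hui := (integral_norm_le_of_eLpNorm_lt hT hT1.le one_pos hu hu1).1
    have hα0 : α = 0 := by rw [hα, ha1, mul_zero, Real.sign_zero]
    have hn := (h₂.solvesModes hMμ hui hT.le).norm_eq_one hMs hui hT.le (right_mem_Icc.2 hT.le)
    rw [(Prod.mk.inj heq).2, exp_smul_smul_eigenstate, norm_smul, orthonormal_eigenvec.1 2, mul_one,
      hα0, Complex.ofReal_zero, mul_zero, zero_mul, add_zero, Complex.norm_real,
      Real.norm_of_nonneg (Real.sqrt_nonneg _)] at hn
    exact (sqrt_one_sub_sq_lt_one hδ).ne hn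
  obtain ⟨K₁, hK₁, hexp₁⟩ := exists_quadratic_expansion hW hV hU hWV hVU hMs hM 1
  obtain ⟨K₂, hK₂, hexp₂⟩ := exists_quadratic_expansion hW hV hU hWV hVU hMs hM 2
  obtain ⟨R₁, hR₁, hin₁⟩ := exists_norm_inner_gauge_sub_le hW 1
  obtain ⟨R₂, hR₂, hin₂⟩ := exists_norm_inner_gauge_sub_le hW 2
  simp only [← hm] at hexp₁ hexp₂
  simp only [← ha] at hin₁ hin₂
  obtain ⟨η, hη, hη1, hobs⟩ := exists_sign_obstruction (add_nonneg hR₁ hR₂) ha1 hA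
  rw [quantityA] at hα
  -- The bound on `T` turns both errors `K_j T S` into at most `η S`; the bound on `u` gives `|s| ≤
  -- η`. The added `1` keeps the denominator positive.
  refine ⟨min 1 (η / (K₁ + K₂ + 1)), by positivity, η, hη,
    fun T hT hTs u hu huη ψ₁ ψ₂ h₁ h₂ δ hδ heq => ?_⟩
  have hT1 : T ≤ 1 := (hTs.trans_le (min_le_left _ _)).le
  have hTK : T * (K₁ + K₂ + 1) ≤ η := by
    rw [← le_div_iff₀ (by positivity)]; exact (hTs.trans_le (min_le_right _ _)).le
  obtain ⟨hui, huint⟩ := integral_norm_le_of_eLpNorm_lt hT hT1 hη hu huη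
  have hy₁ := h₁.solvesModes hMμ hui hT.le
  have hy₂ := h₂.solvesModes hMμ hui hT.le
  set s : ℝ → ℝ := fun t => ∫ τ in (0 : ℝ)..t, u τ with hs
  have hsη : ∀ t ∈ Icc 0 T, |s t| ≤ η := fun t ht =>
    (intervalIntegral.abs_integral_le_integral_abs ht.1).trans
      ((intervalIntegral.integral_mono_interval le_rfl ht.1 ht.2
        (Eventually.of_forall fun τ => abs_nonneg _) hui.abs).trans huint)
  have hs1 : ∀ t ∈ Icc 0 T, |s t| ≤ 1 := fun t ht => (hsη t ht).trans hη1
  have e₁ := hexp₁ T u s _ hT hui (fun _ => rfl) hs1 hy₁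
  have e₂ := hexp₂ T u s _ hT hui (fun _ => rfl) hs1 hy₂
  set S := ∫ t in (0 : ℝ)..T, s t ^ 2 with hS
  have hS0 : 0 ≤ S := intervalIntegral.integral_nonneg hT.le fun _ _ => sq_nonneg _
  have hSη : S ≤ η := by
    have h1 : ‖S‖ ≤ η * |T - 0| := by
      refine intervalIntegral.norm_integral_le_of_norm_le_const fun t ht => ?_
      rw [uIoc_of_le hT.le] at ht
      have h2 := hsη t ⟨ht.1.le, ht.2⟩
      rw [norm_pow, Real.norm_eq_abs]
      nlinarith [abs_nonneg (s t)]
    rw [Real.norm_of_nonneg hS0, sub_zero, abs_of_pos hT] at h1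
    nlinarith
  have hKS : ∀ K, K ≤ K₁ + K₂ + 1 → K * T * S ≤ η * S := fun K hK =>
    mul_le_mul_of_nonneg_right ((mul_le_mul_of_nonneg_right hK hT.le).trans (by linarith)) hS0
  obtain ⟨heq₁, heq₂⟩ := Prod.mk.inj heq
  have hy₁T : Complex.exp (Complex.I * (eigenvalue 1 : ℂ) * (T : ℂ)) • ψ₁ T = eigenvec 1 := by
    have := exp_smul_smul_eigenstate 1 T 1
    rwa [one_smul, one_smul, ← heq₁] at this
  rw [heq₂, exp_smul_smul_eigenstate, inner_smul_right] at e₂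
  rw [hy₁T] at e₁
  have f₁ := hin₁ (s T)
  have f₂ := hin₂ (s T)
  set σ := s T with hσ
  set z₁ := ⟪gauge hW 1 σ, eigenvec 1⟫_ℂ with hz₁
  set z₂ := ⟪gauge hW 2 σ, eigenvec 2⟫_ℂ with hz₂
  -- Only imaginary parts matter, except that the real part of `z₂` multiplies `αδ` in the second
  -- relation.
  have g₁ := (Complex.abs_im_le_norm _).trans f₁
  have g₂ := (Complex.abs_im_le_norm _).trans f₂
  have g₃ := (Complex.abs_re_le_norm _).trans f₂
  have g₄ := (Complex.abs_im_le_norm _).trans (e₁.trans (hKS K₁ (by linarith)))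
  have g₅ := (Complex.abs_im_le_norm _).trans (e₂.trans (hKS K₂ (by linarith)))
  simp only [Complex.add_im, Complex.sub_im, Complex.one_im, Complex.mul_im, Complex.I_re,
    Complex.I_im, Complex.ofReal_re, Complex.ofReal_im, Complex.add_re, Complex.sub_re,
    Complex.one_re, Complex.mul_re, zero_mul, one_mul, mul_zero, zero_add, add_zero, sub_zero,
    sub_self] at g₁ g₂ g₃ g₄ g₅
  have hσ2 := sq_nonneg σ
  have hRσ₁ : R₁ * σ ^ 2 ≤ (R₁ + R₂) * σ ^ 2 := by nlinarith
  have hRσ₂ : R₂ * σ ^ 2 ≤ (R₁ + R₂) * σ ^ 2 := by nlinarith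
  refine hobs σ S δ (Real.sqrt (1 - δ ^ 2)) (z₂.re - 1) (z₂.im + σ * diagCoeff μ 2)
    (hsη T (right_mem_Icc.2 hT.le)) hS0 hSη hδ (Real.sqrt_nonneg _)
    (sqrt_one_sub_sq_lt_one hδ).le (one_sub_sqrt_le hδ) (g₃.trans hRσ₂) (g₂.trans hRσ₂) ?_ ?_
  · rw [abs_le] at g₁ g₄ ⊢
    constructor <;> linarith
  · rw [← hα]
    refine le_of_eq_of_le (congrArg abs ?_) g₅
    ring
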